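/- Let $\gamma>0$, $0\le\alpha\le\beta$, and for $n\in\mathbb N$, $x,t\ge 0$ put $$p_{n,k,\gamma}(x)=\frac{\Gamma(n/\gamma+k)}{\Gamma(k+1)\Gamma(n/\gamma)}\cdot\frac{(\gamma x)^k}{(1+\gamma x)^{n/\gamma+k}}\quad(k\ge 0),\qquad b_{n,k,\gamma}(t)=\frac{\gamma\,\Gamma(n/\gamma+k+1)}{\Gamma(k)\Gamma(n/\gamma+1)}\cdot\frac{(\gamma t)^{k-1}}{(1+\gamma t)^{n/\gamma+k+1}}\quad(k\ge 1),$$ and define the modified Baskakov–Durrmeyer–Stancu operator $$B_{n,\gamma}^{\alpha,\beta}(f,x)=\sum_{k=1}^{\infty}p_{n,k,\gamma}(x)\int_0^\infty b_{n,k,\gamma}(t)\,f\!\left(\frac{nt+\alpha}{n+\beta}\right)dt+p_{n,0,\gamma}(x)\,f\!\left(\frac{\alpha}{n+\beta}\right).$$ Let $\mu>0$ and let $f$ be a continuous real function on $[0,\infty)$ such that, for some $M>0$, $|f(t)|\le M t^{\mu}$ for all $t\ge 0$. Let $r\ge 0$ be an integer and $x\in(0,\infty)$ a point at which $f^{(r)}(x)$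 exists (that is, for $r\ge1$, $f$ is $r-1$ times differentiable in a neighbourhood of $x$ and $f^{(r-1)}$ is differentiable at $x$). Then for all sufficiently large $n$ the integrals and the series defining $B_{n,\gamma}^{\alpha,\beta}(f,y)$ converge absolutely for every $y\ge 0$, the $r$-th derivative $(B_{n,\gamma}^{\alpha,\beta})^{(r)}(f,x)$ of $y\mapsto B_{n,\gamma}^{\alpha,\beta}(f,y)$ at $y=x$ exists, and $$\lim_{n\to\infty}\bigl(B_{n,\gamma}^{\alpha,\beta}\bigr)^{(r)}(f,x)=f^{(r)}(x).$$ -/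

import Mathlib

open Filter Topology MeasureTheory Set

namespace BDS

/-- The Baskakov basis function `p_{n,k,γ}(x)`. -/
noncomputable def p (γ n : ℝ) (k : ℕ) (x : ℝ) : ℝ :=
  Real.Gamma (n / γ + k) / (Real.Gamma (k + 1) * Real.Gamma (n / γ)) *
    ((γ * x) ^ k / (1 + γ * x) ^ (n / γ + k))

/-- The beta basis function `b_{n,k,γ}(t)`; it is only used for `k ≥ 1`. -/
noncomputable def b (γ n : ℝ) (k : ℕ) (t : ℝ) : ℝ :=
  γ * Real.Gamma (n / γ + k + 1) / (Real.Gamma k * Real.Gamma (n / γ + 1)) *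
    ((γ * t) ^ (k - 1) / (1 + γ * t) ^ (n / γ + k + 1))

/-- The integrand `b_{n,k,γ}(t) f((n t + α) / (n + β))`. -/
noncomputable def integrand (γ α β n : ℝ) (f : ℝ → ℝ) (k : ℕ) (t : ℝ) : ℝ :=
  b γ n k t * f ((n * t + α) / (n + β))

/-- The `k`-th term `p_{n,k,γ}(x) ∫₀^∞ b_{n,k,γ}(t) f((n t + α) / (n + β)) dt`
of the series (for `k ≥ 1`). -/
noncomputable def term (γ α β n : ℝ) (f : ℝ → ℝ) (x : ℝ) (k : ℕ) : ℝ :=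
  p γ n k x * ∫ t in Ioi (0 : ℝ), integrand γ α β n f k t

/-- The modified Baskakov–Durrmeyer–Stancu operator `B_{n,γ}^{α,β}(f, x)`; the series runs over
all indices `k + 1` with `k : ℕ`, that is over all integers `≥ 1`. -/
noncomputable def B (γ α β n : ℝ) (f : ℝ → ℝ) (x : ℝ) : ℝ :=
  (∑' k : ℕ, term γ α β n f x (k + 1)) + p γ n 0 x * f (α / (n + β))

/-- The integrals and the series in the definition of `B_{n,γ}^{α,β}(f, x)` converge
absolutely for every `x ∈ [0, ∞)`. -/
def WellDefined (γ α β n : ℝ) (f : ℝ → ℝ) : Prop :=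
  (∀ k : ℕ, 1 ≤ k → IntegrableOn (integrand γ α β n f k) (Ioi (0 : ℝ))) ∧
  ∀ x : ℝ, 0 ≤ x → Summable (fun k : ℕ => term γ α β n f x (k + 1))

/-- The class `C_μ[0, ∞)`: functions continuous on `[0, ∞)` with `|f(t)| ≤ M t^μ` there, for
some `M > 0`. Values at negative arguments play no role. -/
def CMu (μ : ℝ) : Set (ℝ → ℝ) :=
  {f | ContinuousOn f (Ici (0 : ℝ)) ∧ ∃ M : ℝ, 0 < M ∧ ∀ t : ℝ, 0 ≤ t → |f t| ≤ M * t ^ μ}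

/-- The `r`-th derivative of `f` exists at the point `x`: the derivatives of order `< r` exist in
a neighbourhood of `x`, and the one of order `r - 1` is differentiable at `x`.
No condition for `r = 0`. -/
def DerivExistsAt (r : ℕ) (f : ℝ → ℝ) (x : ℝ) : Prop :=
  (∀ i : ℕ, i + 1 < r → ∀ᶠ y in 𝓝 x, DifferentiableAt ℝ (iteratedDeriv i f) y) ∧
  ∀ i : ℕ, i + 1 = r → DifferentiableAt ℝ (iteratedDeriv i f) x

end BDS

/-!
Write `N = n / γ` and `u = γ x`. After the substitution `s = γ t` the operator becomes
`opL N g w = ∑ₖ nb N k w ∫ g dν_{N,k}` with `w = γ y`: a negative binomial mixture of beta prime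
distributions `ν_{N,k}`, applied to the function `g(s) = f((n s / γ + α) / (n + β))`, where
`ν_{N,0}` is the Dirac mass at `0`.

The function `f` is written as `T + h`, with `T` its Taylor polynomial of degree at most `r` at `x`
and `h(t) = o((t - x)^r)` (Peano form, `exists_taylor_peano`, since `f^(r)` exists only at `x`).

*The polynomial part.* The operator maps polynomials of degree at most `r` to polynomials of degree
at most `r`, multiplying the coefficient of degree `r` by a factor `leadFactor N r` that tends to `1`
(`exists_hasSum_opL_eval`, `tendsto_leadFactor`). The derivative of order `r` of such a polynomial
is `r!` times this coefficient, which gives the limit `f^(r)(x)`.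

*The remainder.* The weight `nb N k` extends holomorphically to the right half plane, and
`|nb N k z|` is `D ^ (-N)` times the weight at the real point `|z| / D`, where `D = |1 + z| - |z|`
(`norm_cnb_eq`). On the circle of radius `ρ = N ^ (-1/2)` about `u` one has `D = 1 - O(ρ²)`, so that
`D ^ (-N)` is bounded, and `|z| / D - u = O(ρ)` (`weight_point_bounds`). Cauchy's estimate therefore
bounds the derivative of order `r` of `opL N h` at `u` by a constant times
`ρ ^ (-r) sup opL N |h| w`, the supremum being over `|w - u| ≤ 5 ρ` (`abs_iteratedDeriv_opL_le`).
Since `|h(t)| ≤ ε |t - x|^r + C (t - x)^(2m)` with `2m > r`, and since moments of order `j` about a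
point at distance `O(ρ)` are `O(ρ^j)` (`exists_opL_sub_pow_le`), this is `O(ε) + O(C ρ)`. The moment
bounds follow from the Stein identities of the two families of distributions, `tsum_nb_stein` and
`integral_betaPrime_stein`, by recursion on the order.
-/

namespace BDS

/-! ### Negative binomial weights -/

/-- The negative binomial weight `Γ(N+k)/(k! Γ(N)) · w^k/(1+w)^(N+k)`, that is the Baskakov basis
function normalized to `γ = 1`, with a real parameter `N`. -/
noncomputable def nb (N : ℝ) (k : ℕ) (w : ℝ) : ℝ :=
  Real.Gamma (N + k) / (Real.Gamma (k + 1) * Real.Gamma N) * (w ^ k / (1 + w) ^ (N + k))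

lemma gamma_add_nat {N : ℝ} (hN : 0 < N) (k : ℕ) :
    Real.Gamma (N + k) = (ascPochhammer ℝ k).eval N * Real.Gamma N := by
  induction k with
  | zero => simp
  | succ k ih =>
    have h : N + ((k + 1 : ℕ) : ℝ) = (N + k) + 1 := by push_cast; ring
    rw [h, Real.Gamma_add_one (by positivity), ih, ascPochhammer_succ_eval]
    ring

lemma nb_nonneg {N w : ℝ} (hN : 0 < N) (hw : 0 ≤ w) (k : ℕ) : 0 ≤ nb N k w := by
  have h1 : 0 < Real.Gamma (N + k) := Real.Gamma_pos_of_pos (by positivity)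
  have h2 : 0 < Real.Gamma ((k : ℝ) + 1) := Real.Gamma_pos_of_pos (by positivity)
  have h3 : 0 < Real.Gamma N := Real.Gamma_pos_of_pos hN
  unfold nb
  positivity

lemma hasSum_nb {N w : ℝ} (hN : 0 < N) (hw : 0 ≤ w) : HasSum (fun k => nb N k w) 1 := by
  have h1w : 0 < 1 + w := by linarith
  have hq1 : w / (1 + w) < 1 := by rw [div_lt_one h1w]; linarith
  have hq0 : 0 ≤ w / (1 + w) := by positivity
  have h1q : 1 - w / (1 + w) = (1 + w)⁻¹ := by field_simp; ring
  have hs := (Real.one_div_one_sub_rpow_hasFPowerSeriesOnBall_zero N).hasSum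
    (y := w / (1 + w)) (by
      rw [← ENNReal.ofReal_one, Metric.eball_ofReal]
      simpa [abs_of_nonneg h1w.le, abs_of_nonneg hw] using hq1)
  have hs2 := hs.mul_right ((1 - w / (1 + w)) ^ N)
  rw [zero_add, one_div, inv_mul_cancel₀
    (Real.rpow_pos_of_pos (by linarith) N).ne'] at hs2
  refine hs2.congr_fun fun k => ?_
  have hmc : (k.factorial : ℝ) * Ring.multichoose N k = (ascPochhammer ℝ k).eval N := by
    have := Ring.factorial_nsmul_multichoose_eq_ascPochhammer N k
    rwa [Polynomial.ascPochhammer_smeval_eq_eval, nsmul_eq_mul] at this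
  have hG : Real.Gamma N ≠ 0 := (Real.Gamma_pos_of_pos hN).ne'
  have hf : (k.factorial : ℝ) ≠ 0 := by positivity
  have hr : (1 + w) ^ N ≠ 0 := (Real.rpow_pos_of_pos h1w N).ne'
  rw [nb, gamma_add_nat hN, Real.Gamma_nat_eq_factorial, ← hmc, h1q, Real.inv_rpow h1w.le,
    Real.rpow_add h1w, Real.rpow_natCast, FormalMultilinearSeries.ofScalars_apply_eq,
    ← Ring.multichoose_eq, smul_eq_mul, div_pow]
  field_simp

/-- Multiplying by a falling factorial shifts both parameters of the weight. -/
lemma nb_mul_descFactorial {N w : ℝ} (hN : 0 < N) (hw : 0 ≤ w) (k j : ℕ) :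
    nb N (k + j) w * ((k + j).descFactorial j : ℝ) =
      (ascPochhammer ℝ j).eval N * w ^ j * nb (N + j) k w := by
  have h1w : 0 < 1 + w := by linarith
  have hG : Real.Gamma N ≠ 0 := (Real.Gamma_pos_of_pos hN).ne'
  have hA : (ascPochhammer ℝ j).eval N ≠ 0 := (ascPochhammer_pos j N hN).ne'
  have hf : (k.factorial : ℝ) ≠ 0 := by positivity
  have hd : (k.factorial : ℝ) * ((k + j).descFactorial j : ℝ) = ((k + j).factorial : ℝ) := by
    have := Nat.factorial_mul_descFactorial (n := k + j) (k := j) (by omega)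
    rw [Nat.add_sub_cancel] at this
    exact_mod_cast this
  have hd0 : ((k + j).descFactorial j : ℝ) ≠ 0 := by
    intro h
    rw [h, mul_zero] at hd
    have : ((k + j).factorial : ℝ) ≠ 0 := by positivity
    exact this hd.symm
  have he : N + ((k + j : ℕ) : ℝ) = N + j + k := by push_cast; ring
  have hr : (1 + w) ^ (N + j + k) ≠ 0 := (Real.rpow_pos_of_pos h1w _).ne'
  rw [nb, nb, he, Real.Gamma_nat_eq_factorial, Real.Gamma_nat_eq_factorial, ← hd,
    gamma_add_nat hN j, pow_add]
  field_simp

lemma hasSum_nb_mul_descFactorial {N w : ℝ} (hN : 0 < N) (hw : 0 ≤ w) (j : ℕ) :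
    HasSum (fun k => nb N k w * (k.descFactorial j : ℝ)) ((ascPochhammer ℝ j).eval N * w ^ j) := by
  have h := (hasSum_nb (N := N + j) (by positivity) hw).mul_left
    ((ascPochhammer ℝ j).eval N * w ^ j)
  rw [mul_one] at h
  rw [← (add_left_injective j).hasSum_iff]
  · exact h.congr_fun fun k => nb_mul_descFactorial hN hw k j
  · intro k hk
    have : k < j := by
      by_contra hkj
      exact hk ⟨k - j, by simp only; omega⟩
    simp [Nat.descFactorial_of_lt this]

open Polynomial in
/-- The negative binomial expectation of a polynomial of degree at most `j` is a polynomial of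
degree at most `j` in `w`, and the coefficient of degree `j` is multiplied by
`N (N + 1) ⋯ (N + j - 1)`. -/
lemma exists_hasSum_nb_mul_eval {N : ℝ} (hN : 0 < N) (j : ℕ) :
    ∀ F : ℝ[X], F.natDegree ≤ j → ∃ Q : ℝ[X], Q.natDegree ≤ j ∧
      Q.coeff j = F.coeff j * (ascPochhammer ℝ j).eval N ∧
      ∀ w : ℝ, 0 ≤ w → HasSum (fun k : ℕ => nb N k w * F.eval (k : ℝ)) (Q.eval w) := by
  induction j with
  | zero =>
    intro F hF
    have hF := eq_C_of_natDegree_le_zero hF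
    refine ⟨C (F.coeff 0), by simp, by simp, fun w hw => ?_⟩
    rw [hF]
    simpa using (hasSum_nb hN hw).mul_right (F.coeff 0)
  | succ j ih =>
    intro F hF
    set c := F.coeff (j + 1) with hc
    have hmon := monic_descPochhammer ℝ (j + 1)
    have hdeg : (descPochhammer ℝ (j + 1)).natDegree = j + 1 := descPochhammer_natDegree ℝ _
    have hF' : (F - C c * descPochhammer ℝ (j + 1)).natDegree ≤ j := by
      rw [natDegree_le_iff_coeff_eq_zero]
      intro i hi
      rcases (Nat.succ_le_of_lt hi).eq_or_lt with h | h
      · have h1 : (descPochhammer ℝ (j + 1)).coeff (j + 1) = 1 := by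
          have := hmon.coeff_natDegree
          rwa [hdeg] at this
        rw [← h, Nat.succ_eq_add_one, coeff_sub, coeff_C_mul, h1, ← hc]
        ring
      · rw [coeff_sub, coeff_C_mul, coeff_eq_zero_of_natDegree_lt (lt_of_le_of_lt hF h),
          coeff_eq_zero_of_natDegree_lt (p := descPochhammer ℝ (j + 1)) (by rw [hdeg]; exact h)]
        ring
    obtain ⟨Q, hQ1, -, hQ3⟩ := ih _ hF'
    refine ⟨C (c * (ascPochhammer ℝ (j + 1)).eval N) * X ^ (j + 1) + Q, ?_, ?_, ?_⟩
    · exact natDegree_add_le_of_degree_le (natDegree_C_mul_X_pow_le _ _) (hQ1.trans (by omega))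
    · rw [coeff_add, coeff_eq_zero_of_natDegree_lt (p := Q) (by omega), coeff_C_mul,
        coeff_X_pow_self]
      ring
    · intro w hw
      have h1 := ((hasSum_nb_mul_descFactorial hN hw (j + 1)).mul_left c).add (hQ3 w hw)
      rw [eval_add, eval_mul, eval_C, eval_pow, eval_X, mul_assoc]
      refine h1.congr_fun fun k => ?_
      rw [eval_sub, eval_mul, eval_C, descPochhammer_eval_eq_descFactorial]
      ring

lemma summable_nb_mul_eval {N w : ℝ} (hN : 0 < N) (hw : 0 ≤ w) (F : Polynomial ℝ) :
    Summable (fun k : ℕ => nb N k w * F.eval (k : ℝ)) := by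
  obtain ⟨Q, -, -, hQ⟩ := exists_hasSum_nb_mul_eval hN F.natDegree F le_rfl
  exact (hQ w hw).summable

lemma nb_succ {N w : ℝ} (hN : 0 < N) (hw : 0 ≤ w) (k : ℕ) :
    (1 + w) * (((k + 1 : ℕ) : ℝ) * nb N (k + 1) w) = w * ((N + k) * nb N k w) := by
  have h1w : 0 < 1 + w := by linarith
  have hG : Real.Gamma N ≠ 0 := (Real.Gamma_pos_of_pos hN).ne'
  have hf : (k.factorial : ℝ) ≠ 0 := by positivity
  have hk : (k : ℝ) + 1 ≠ 0 := by positivity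
  have he : N + ((k + 1 : ℕ) : ℝ) = N + k + 1 := by push_cast; ring
  have hr : (1 + w) ^ (N + k) ≠ 0 := (Real.rpow_pos_of_pos h1w _).ne'
  rw [nb, nb, he, Real.Gamma_nat_eq_factorial, Real.Gamma_nat_eq_factorial, Nat.factorial_succ,
    Real.Gamma_add_one (by positivity), Real.rpow_add_one h1w.ne', pow_succ]
  push_cast
  field_simp

open Polynomial in
/-- Stein identity for the negative binomial distribution (summation by parts). -/
lemma tsum_nb_stein {N w : ℝ} (hN : 0 < N) (hw : 0 ≤ w) (F : ℝ[X]) :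
    ∑' k : ℕ, nb N k w * ((k - N * w) * F.eval (k : ℝ)) =
      w * ∑' k : ℕ, nb N k w * ((N + k) * (F.eval ((k : ℝ) + 1) - F.eval (k : ℝ))) := by
  have s1 : Summable fun k : ℕ => nb N k w * (k * F.eval (k : ℝ)) := by
    refine (summable_nb_mul_eval hN hw (X * F)).congr fun k => ?_
    rw [eval_mul, eval_X]
  have s2 : Summable fun k : ℕ => nb N k w * ((N + k) * F.eval (k : ℝ)) := by
    refine (summable_nb_mul_eval hN hw ((C N + X) * F)).congr fun k => ?_
    rw [eval_mul, eval_add, eval_C, eval_X]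
  have s3 : Summable fun k : ℕ => nb N k w * ((N + k) * F.eval ((k : ℝ) + 1)) := by
    refine (summable_nb_mul_eval hN hw ((C N + X) * F.comp (X + 1))).congr fun k => ?_
    rw [eval_mul, eval_add, eval_C, eval_X, eval_comp, eval_add, eval_X, eval_one]
  have key : (1 + w) * ∑' k : ℕ, nb N k w * (k * F.eval (k : ℝ)) =
      w * ∑' k : ℕ, nb N k w * ((N + k) * F.eval ((k : ℝ) + 1)) := by
    rw [s1.tsum_eq_zero_add]
    simp only [Nat.cast_zero, zero_mul, mul_zero, zero_add]
    rw [← tsum_mul_left, ← tsum_mul_left]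
    congr 1
    funext k
    have := nb_succ hN hw k
    push_cast at this ⊢
    linear_combination F.eval ((k : ℝ) + 1) * this
  have e1 : ∑' k : ℕ, nb N k w * ((k - N * w) * F.eval (k : ℝ)) =
      (1 + w) * ∑' k : ℕ, nb N k w * (k * F.eval (k : ℝ)) -
      w * ∑' k : ℕ, nb N k w * ((N + k) * F.eval (k : ℝ)) := by
    rw [← tsum_mul_left, ← tsum_mul_left, ← (s1.mul_left _).tsum_sub (s2.mul_left _)]
    congr 1
    funext k
    ring
  rw [e1, key, ← mul_sub, ← s3.tsum_sub s2]
  congr 2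
  funext k
  ring

/-- The central moment of order `j` of `k / N` under the negative binomial weights. -/
noncomputable def nbMoment (N w : ℝ) (j : ℕ) : ℝ := ∑' k : ℕ, nb N k w * (k / N - w) ^ j

open Polynomial in
lemma summable_nb_central {N w : ℝ} (hN : 0 < N) (hw : 0 ≤ w) (j : ℕ) :
    Summable fun k : ℕ => nb N k w * (k / N - w) ^ j := by
  have := summable_nb_mul_eval hN hw ((C N⁻¹ * X - C w) ^ j)
  simpa [div_eq_inv_mul] using this

open Polynomial in
/-- Recursion for the central moments, from the Stein identity for `v ^ j` with `v = k / N - w`. -/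
lemma nbMoment_succ {N w : ℝ} (hN : 0 < N) (hw : 0 ≤ w) (j : ℕ) :
    nbMoment N w (j + 1) = w * ∑ i ∈ Finset.range j,
      (j.choose i : ℝ) * N⁻¹ ^ (j - i) * ((1 + w) * nbMoment N w i + nbMoment N w (i + 1)) := by
  have h := tsum_nb_stein hN hw ((C N⁻¹ * X - C w) ^ j)
  have hl : ∑' k : ℕ, nb N k w * ((k - N * w) * ((C N⁻¹ * X - C w) ^ j).eval (k : ℝ)) =
      N * nbMoment N w (j + 1) := by
    rw [nbMoment, ← tsum_mul_left]
    congr 1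
    funext k
    simp only [eval_pow, eval_sub, eval_mul, eval_C, eval_X]
    rw [pow_succ, div_eq_inv_mul]
    field_simp
  have hr : ∑' k : ℕ, nb N k w * ((N + k) * (((C N⁻¹ * X - C w) ^ j).eval ((k : ℝ) + 1) -
      ((C N⁻¹ * X - C w) ^ j).eval (k : ℝ))) = N * ∑ i ∈ Finset.range j,
      (j.choose i : ℝ) * N⁻¹ ^ (j - i) * ((1 + w) * nbMoment N w i + nbMoment N w (i + 1)) := by
    have hi : ∀ i, (j.choose i : ℝ) * N⁻¹ ^ (j - i) *
        ((1 + w) * nbMoment N w i + nbMoment N w (i + 1)) =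
        ∑' k : ℕ, (j.choose i : ℝ) * N⁻¹ ^ (j - i) * ((1 + w) * (nb N k w * (k / N - w) ^ i) +
          nb N k w * (k / N - w) ^ (i + 1)) := by
      intro i
      rw [tsum_mul_left, Summable.tsum_add ((summable_nb_central hN hw i).mul_left _)
        (summable_nb_central hN hw _), tsum_mul_left]
      rfl
    simp_rw [hi]
    rw [← Summable.tsum_finsetSum, ← tsum_mul_left]
    · congr 1
      funext k
      simp only [eval_pow, eval_sub, eval_mul, eval_C, eval_X]
      have e : N⁻¹ * ((k : ℝ) + 1) - w = (k / N - w) + N⁻¹ := by ring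
      rw [e, ← div_eq_inv_mul, add_pow, Finset.sum_range_succ]
      simp only [Nat.sub_self, pow_zero, Nat.choose_self, Nat.cast_one, mul_one]
      rw [add_sub_cancel_right]
      have e2 : N + (k : ℝ) = N * (1 + w + (k / N - w)) := by field_simp; ring
      rw [e2, Finset.mul_sum, Finset.mul_sum, Finset.mul_sum]
      refine Finset.sum_congr rfl fun i _ => ?_
      ring
    · intro i _
      exact (((summable_nb_central hN hw i).mul_left _).add
        (summable_nb_central hN hw _)).mul_left _
  rw [hl, hr] at h
  have : N * nbMoment N w (j + 1) = N * (w * ∑ i ∈ Finset.range j,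
      (j.choose i : ℝ) * N⁻¹ ^ (j - i) * ((1 + w) * nbMoment N w i + nbMoment N w (i + 1))) := by
    rw [h]; ring
  exact mul_left_cancel₀ hN.ne' this

/-- The central moments of order `j` are `O(N ^ (-j / 2))`, uniformly for bounded `w`. The
quantity `N ^ (-1 / 2)` is represented by a number `ρ` with `N * ρ ^ 2 = 1`. -/
lemma exists_abs_nbMoment_le (W : ℝ) (j : ℕ) : ∃ C : ℝ, 0 ≤ C ∧
    ∀ N ρ w : ℝ, 0 < ρ → ρ ≤ 1 → N * ρ ^ 2 = 1 → 0 ≤ w → w ≤ W →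
      |nbMoment N w j| ≤ C * ρ ^ j := by
  induction j using Nat.strong_induction_on with
  | _ j ih =>
    rcases j with _ | j
    · refine ⟨1, zero_le_one, fun N ρ w hρ _ hN hw _ => ?_⟩
      have hN0 : 0 < N := by
        by_contra hneg
        nlinarith [sq_nonneg ρ]
      simp [nbMoment, (hasSum_nb hN0 hw).tsum_eq]
    · choose! C hC0 hC using ih
      refine ⟨|W| * ∑ i ∈ Finset.range j, (j.choose i : ℝ) * ((1 + |W|) * C i + C (i + 1)),
        ?_, fun N ρ w hρ hρ1 hN hw hwW => ?_⟩
      · refine mul_nonneg (abs_nonneg _) (Finset.sum_nonneg fun i hi => ?_)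
        have hi' := Finset.mem_range.mp hi
        have := hC0 i (by omega)
        have := hC0 (i + 1) (by omega)
        positivity
      have hN0 : 0 < N := by
        by_contra hneg
        nlinarith [sq_nonneg ρ]
      have hNi : N⁻¹ = ρ ^ 2 := by
        rw [inv_eq_iff_eq_inv]; exact eq_inv_of_mul_eq_one_left hN
      have hwW' : w ≤ |W| := hwW.trans (le_abs_self W)
      rw [nbMoment_succ hN0 hw, abs_mul, abs_of_nonneg hw, mul_assoc]
      refine mul_le_mul hwW' ?_ (abs_nonneg _) (abs_nonneg _)
      rw [Finset.sum_mul]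
      refine (Finset.abs_sum_le_sum_abs _ _).trans (Finset.sum_le_sum fun i hi => ?_)
      have hi' := Finset.mem_range.mp hi
      have h0 := hC i (by omega) N ρ w hρ hρ1 hN hw hwW
      have h1 := hC (i + 1) (by omega) N ρ w hρ hρ1 hN hw hwW
      have c0 := hC0 i (by omega)
      have c1 := hC0 (i + 1) (by omega)
      have h1' : |nbMoment N w (i + 1)| ≤ C (i + 1) * ρ ^ i :=
        h1.trans (mul_le_mul_of_nonneg_left
          (pow_le_pow_of_le_one hρ.le hρ1 (by omega)) c1)
      have hp : (ρ ^ 2) ^ (j - i) * ρ ^ i ≤ ρ ^ (j + 1) := by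
        rw [← pow_mul, ← pow_add]
        exact pow_le_pow_of_le_one hρ.le hρ1 (by omega)
      have hin : |(1 + w) * nbMoment N w i + nbMoment N w (i + 1)| ≤
          ((1 + |W|) * C i + C (i + 1)) * ρ ^ i := by
        refine (abs_add_le _ _).trans ?_
        rw [abs_mul, abs_of_nonneg (by linarith : 0 ≤ 1 + w), add_mul _ _ (ρ ^ i), mul_assoc]
        refine add_le_add ?_ h1'
        exact mul_le_mul (by linarith) h0 (abs_nonneg _) (by positivity)
      rw [hNi, abs_mul, abs_of_nonneg (by positivity : (0 : ℝ) ≤ (j.choose i : ℝ) * (ρ ^ 2) ^ (j - i))]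
      calc (j.choose i : ℝ) * (ρ ^ 2) ^ (j - i) *
            |(1 + w) * nbMoment N w i + nbMoment N w (i + 1)|
          ≤ (j.choose i : ℝ) * (ρ ^ 2) ^ (j - i) * (((1 + |W|) * C i + C (i + 1)) * ρ ^ i) := by
            gcongr
        _ = (j.choose i : ℝ) * ((1 + |W|) * C i + C (i + 1)) * ((ρ ^ 2) ^ (j - i) * ρ ^ i) := by
            ring
        _ ≤ _ := by gcongr

/-! ### Beta prime distributions -/

lemma integrableOn_pow_div_rpow {m : ℕ} {c : ℝ} (hc : (m : ℝ) + 1 < c) :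
    IntegrableOn (fun s : ℝ => s ^ m / (1 + s) ^ c) (Ioi 0) := by
  have h := integrableOn_add_rpow_Ioi_of_lt (a := (m : ℝ) - c) (c := 0) (m := 1)
    (by linarith) (by norm_num)
  refine Integrable.mono' h ?_ ?_
  · refine ContinuousOn.aestronglyMeasurable (fun s hs => ?_) measurableSet_Ioi
    have hs : (0 : ℝ) < s := hs
    have h1 : 1 + s ≠ 0 := by linarith
    have h2 : (1 + s) ^ c ≠ 0 := (Real.rpow_pos_of_pos (by linarith) c).ne'
    apply ContinuousAt.continuousWithinAt
    exact (by fun_prop : ContinuousAt (fun s : ℝ => s ^ m) s).div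
      ((by fun_prop : ContinuousAt (fun s : ℝ => 1 + s) s).rpow_const (Or.inl h1)) h2
  · refine (ae_restrict_iff' measurableSet_Ioi).mpr (Eventually.of_forall fun s hs => ?_)
    have hs : (0 : ℝ) < s := hs
    have h1 : 0 < 1 + s := by linarith
    have h2 : 0 < (1 + s) ^ c := Real.rpow_pos_of_pos h1 c
    rw [Real.norm_of_nonneg (by positivity), add_comm s 1, Real.rpow_sub h1, Real.rpow_natCast]
    gcongr
    linarith

lemma tendsto_pow_div_rpow {m : ℕ} {c : ℝ} (hc : (m : ℝ) < c) :
    Tendsto (fun s : ℝ => s ^ m / (1 + s) ^ c) atTop (𝓝 0) := by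
  have h : Tendsto (fun s : ℝ => (1 + s) ^ (-(c - m))) atTop (𝓝 0) :=
    (tendsto_rpow_neg_atTop (by linarith)).comp (tendsto_atTop_add_const_left _ 1 tendsto_id)
  refine squeeze_zero' ?_ ?_ h
  · filter_upwards [eventually_ge_atTop 0] with s hs
    positivity
  · filter_upwards [eventually_ge_atTop 0] with s hs
    have h1 : 0 < 1 + s := by linarith
    have h2 : 0 < (1 + s) ^ c := Real.rpow_pos_of_pos h1 c
    rw [neg_sub, Real.rpow_sub h1, Real.rpow_natCast]
    gcongr
    linarith

lemma hasDerivAt_pow_div_rpow (m : ℕ) (c : ℝ) {s : ℝ} (hs : 0 < s) :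
    HasDerivAt (fun s : ℝ => s ^ m / (1 + s) ^ c)
      (m * (s ^ (m - 1) / (1 + s) ^ c) - c * (s ^ m / (1 + s) ^ (c + 1))) s := by
  have h1 : 0 < 1 + s := by linarith
  have h2 : (1 + s) ^ c ≠ 0 := (Real.rpow_pos_of_pos h1 c).ne'
  have hd := (hasDerivAt_pow m s).div
    (((hasDerivAt_id s).const_add 1).rpow_const (p := c) (Or.inl h1.ne')) h2
  refine hd.congr_deriv ?_
  simp only [id]
  rw [Real.rpow_sub_one h1.ne', Real.rpow_add_one h1.ne']
  field_simp

/-- Beta integral on the half line, with a natural number as one of the parameters. -/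
lemma integral_pow_div_rpow (m : ℕ) : ∀ c : ℝ, (m : ℝ) + 1 < c →
    ∫ s in Ioi (0 : ℝ), s ^ m / (1 + s) ^ c =
      Real.Gamma (m + 1) * Real.Gamma (c - m - 1) / Real.Gamma c := by
  have hcont : ∀ (m : ℕ) (c : ℝ),
      ContinuousWithinAt (fun s : ℝ => s ^ m / (1 + s) ^ c) (Ici 0) 0 := by
    intro m c
    apply ContinuousAt.continuousWithinAt
    exact (by fun_prop : ContinuousAt (fun s : ℝ => s ^ m) 0).div
      ((by fun_prop : ContinuousAt (fun s : ℝ => 1 + s) 0).rpow_const (Or.inl (by norm_num)))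
      (by simp)
  induction m with
  | zero =>
    intro c hc
    have hc1 : 1 < c := by simpa using hc
    have hi : IntegrableOn (fun s : ℝ => s ^ 0 / (1 + s) ^ c) (Ioi 0) :=
      integrableOn_pow_div_rpow hc
    have hf := integral_Ioi_of_hasDerivAt_of_tendsto (hcont 0 (c - 1))
      (f' := fun s => -(c - 1) * (s ^ 0 / (1 + s) ^ c))
      (fun s hs => (hasDerivAt_pow_div_rpow 0 (c - 1) hs).congr_deriv (by simp; ring))
      (hi.const_mul _) (tendsto_pow_div_rpow (by simpa using hc1))
    rw [integral_const_mul] at hf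
    have hg : Real.Gamma c = (c - 1) * Real.Gamma (c - 1) := by
      rw [← Real.Gamma_add_one (by linarith)]; ring_nf
    have hg0 : Real.Gamma (c - 1) ≠ 0 := (Real.Gamma_pos_of_pos (by linarith)).ne'
    have hc0 : c - 1 ≠ 0 := by linarith
    simp only [Nat.cast_zero, zero_add, sub_zero, Real.Gamma_one, one_mul]
    rw [hg]
    simp only [pow_zero, add_zero, Real.one_rpow] at hf ⊢
    field_simp
    linarith
  | succ m ih =>
    intro c hc
    push_cast at hc
    have hi1 : IntegrableOn (fun s : ℝ => s ^ m / (1 + s) ^ (c - 1)) (Ioi 0) :=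
      integrableOn_pow_div_rpow (by linarith)
    have hi2 : IntegrableOn (fun s : ℝ => s ^ (m + 1) / (1 + s) ^ c) (Ioi 0) :=
      integrableOn_pow_div_rpow (by push_cast; linarith)
    have hf := integral_Ioi_of_hasDerivAt_of_tendsto (hcont (m + 1) (c - 1))
      (f' := fun s => ((m + 1 : ℕ) : ℝ) * (s ^ m / (1 + s) ^ (c - 1)) -
        (c - 1) * (s ^ (m + 1) / (1 + s) ^ c))
      (fun s hs => (hasDerivAt_pow_div_rpow (m + 1) (c - 1) hs).congr_deriv (by simp))
      ((hi1.const_mul _).sub (hi2.const_mul _))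
      (tendsto_pow_div_rpow (by push_cast; linarith))
    rw [integral_sub (hi1.const_mul _) (hi2.const_mul _), integral_const_mul, integral_const_mul,
      ih (c - 1) (by linarith)] at hf
    have hg : Real.Gamma c = (c - 1) * Real.Gamma (c - 1) := by
      rw [← Real.Gamma_add_one (by have : (0 : ℝ) ≤ m := by positivity
                                   linarith)]; ring_nf
    have hm : (0 : ℝ) ≤ m := by positivity
    have hg0 : Real.Gamma (c - 1) ≠ 0 := (Real.Gamma_pos_of_pos (by linarith)).ne'
    have hc0 : c - 1 ≠ 0 := by linarith
    have hg2 : Real.Gamma (((m + 1 : ℕ) : ℝ) + 1) = (m + 1) * Real.Gamma (m + 1) := by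
      push_cast; rw [Real.Gamma_add_one (by positivity)]
    have he : c - ((m + 1 : ℕ) : ℝ) - 1 = c - 1 - m - 1 := by push_cast; ring
    rw [hg, hg2, he]
    push_cast at hf
    simp only [zero_pow (Nat.succ_ne_zero m), zero_div, sub_zero] at hf
    field_simp at hf ⊢
    linarith

/-- The beta prime density with parameters `k` and `N + 1`, that is the Durrmeyer kernel
normalized to `γ = 1`; it is only used for `k ≥ 1`. -/
noncomputable def bp (N : ℝ) (k : ℕ) (s : ℝ) : ℝ :=
  Real.Gamma (N + k + 1) / (Real.Gamma k * Real.Gamma (N + 1)) *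
    (s ^ (k - 1) / (1 + s) ^ (N + k + 1))

/-- The beta prime distribution with parameters `k` and `N + 1` on `(0, ∞)`. For `k = 0` it is the
Dirac mass at `0`, so that the value at the origin in the definition of the operator is the term
of index `0` of one single series. -/
noncomputable def betaPrime (N : ℝ) (k : ℕ) : Measure ℝ :=
  if k = 0 then Measure.dirac 0 else
    (volume.restrict (Ioi (0 : ℝ))).withDensity fun s => ENNReal.ofReal (bp N k s)

lemma measurable_bp (N : ℝ) (k : ℕ) : Measurable (bp N k) := by
  unfold bp; fun_prop

lemma bp_nonneg {N : ℝ} (hN : 0 < N) {k : ℕ} {s : ℝ} (hs : 0 ≤ s) : 0 ≤ bp N k s := by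
  have h1 : 0 < Real.Gamma (N + k + 1) := Real.Gamma_pos_of_pos (by positivity)
  have h2 : 0 ≤ Real.Gamma k := Real.Gamma_nonneg_of_nonneg (by positivity)
  have h3 : 0 < Real.Gamma (N + 1) := Real.Gamma_pos_of_pos (by positivity)
  unfold bp
  positivity

lemma integrable_betaPrime_iff {N : ℝ} (hN : 0 < N) {k : ℕ} (hk : k ≠ 0) {g : ℝ → ℝ} :
    Integrable g (betaPrime N k) ↔ IntegrableOn (fun s => bp N k s * g s) (Ioi 0) := by
  rw [betaPrime, if_neg hk, integrable_withDensity_iff_integrable_smul'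
    (measurable_bp N k).ennreal_ofReal (by simp)]
  refine integrableOn_congr_fun (fun s hs => ?_) measurableSet_Ioi
  simp only [smul_eq_mul]
  rw [ENNReal.toReal_ofReal (bp_nonneg hN (le_of_lt hs))]

lemma integral_betaPrime {N : ℝ} (hN : 0 < N) {k : ℕ} (hk : k ≠ 0) (g : ℝ → ℝ) :
    ∫ s, g s ∂betaPrime N k = ∫ s in Ioi (0 : ℝ), bp N k s * g s := by
  rw [betaPrime, if_neg hk, integral_withDensity_eq_integral_toReal_smul
    (measurable_bp N k).ennreal_ofReal (by simp)]
  refine setIntegral_congr_fun measurableSet_Ioi (fun s hs => ?_)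
  simp only [smul_eq_mul]
  rw [ENNReal.toReal_ofReal (bp_nonneg hN (le_of_lt hs))]

lemma integral_betaPrime_zero (N : ℝ) (g : ℝ → ℝ) : ∫ s, g s ∂betaPrime N 0 = g 0 := by
  simp [betaPrime]

lemma ae_nonneg_betaPrime (N : ℝ) (k : ℕ) : ∀ᵐ s ∂betaPrime N k, 0 ≤ s := by
  rw [betaPrime]
  split_ifs with hk
  · rw [ae_dirac_eq]; simp
  · apply (withDensity_absolutelyContinuous _ _).ae_le
    filter_upwards [ae_restrict_mem measurableSet_Ioi] with s hs
    exact le_of_lt hs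

lemma bp_mul_pow (N : ℝ) (k j : ℕ) (s : ℝ) :
    bp N k s * s ^ j = Real.Gamma (N + k + 1) / (Real.Gamma k * Real.Gamma (N + 1)) *
      (s ^ (k - 1 + j) / (1 + s) ^ (N + k + 1)) := by
  rw [bp, pow_add]; ring

lemma integrable_pow_betaPrime {N : ℝ} (hN : 0 < N) (k : ℕ) {j : ℕ} (hj : (j : ℝ) < N + 1) :
    Integrable (fun s => s ^ j) (betaPrime N k) := by
  rcases eq_or_ne k 0 with rfl | hk
  · simp only [betaPrime, if_pos]
    exact integrable_dirac (by simp)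
  · rw [integrable_betaPrime_iff hN hk]
    simp_rw [bp_mul_pow]
    refine (integrableOn_pow_div_rpow ?_).const_mul _
    have : ((k - 1 + j : ℕ) : ℝ) + 1 = k + j := by
      have : k - 1 + j + 1 = k + j := by omega
      exact_mod_cast this
    linarith

lemma integral_pow_betaPrime {N : ℝ} (hN : 0 < N) (k : ℕ) {j : ℕ} (hj : (j : ℝ) < N + 1) :
    ∫ s, s ^ j ∂betaPrime N k =
      (ascPochhammer ℝ j).eval (k : ℝ) * (Real.Gamma (N + 1 - j) / Real.Gamma (N + 1)) := by
  have hG : Real.Gamma (N + 1) ≠ 0 := (Real.Gamma_pos_of_pos (by positivity)).ne'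
  rcases eq_or_ne k 0 with rfl | hk
  · rw [integral_betaPrime_zero]
    rcases eq_or_ne j 0 with rfl | hj
    · simp [hG]
    · simp [hj, ascPochhammer_ne_zero_eval_zero]
  · rw [integral_betaPrime hN hk]
    simp_rw [bp_mul_pow]
    have hkj : ((k - 1 + j : ℕ) : ℝ) + 1 = k + j := by
      have : k - 1 + j + 1 = k + j := by omega
      exact_mod_cast this
    have hk0 : (0 : ℝ) < k := by positivity
    have h1 : Real.Gamma (N + k + 1) ≠ 0 := (Real.Gamma_pos_of_pos (by positivity)).ne'
    have h2 : Real.Gamma k ≠ 0 := (Real.Gamma_pos_of_pos hk0).ne'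
    have he : N + k + 1 - ((k - 1 + j : ℕ) : ℝ) - 1 = N + 1 - j := by linarith
    rw [integral_const_mul, integral_pow_div_rpow _ _ (by linarith), he, hkj, gamma_add_nat hk0]
    field_simp

open Polynomial

lemma integrable_eval_betaPrime {N : ℝ} (hN : 0 < N) (k : ℕ) (F : ℝ[X])
    (hF : (F.natDegree : ℝ) < N + 1) : Integrable (fun s => F.eval s) (betaPrime N k) := by
  simp_rw [eval_eq_sum_range]
  refine integrable_finsetSum _ fun i hi => ?_
  refine (integrable_pow_betaPrime hN k (lt_of_le_of_lt ?_ hF)).const_mul _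
  have := Finset.mem_range_succ_iff.mp hi
  exact_mod_cast this

/-- Stein identity for the beta prime distribution (integration by parts). -/
lemma integral_betaPrime_stein {N : ℝ} (hN : 0 < N) (k d : ℕ) (hd : (d : ℝ) < N) (F : ℝ[X])
    (hF : F.natDegree ≤ d) :
    ∫ s, (N * s - k) * F.eval s ∂betaPrime N k =
      ∫ s, s * (1 + s) * (derivative F).eval s ∂betaPrime N k := by
  have hi1 : ∀ G : ℝ[X], G.natDegree ≤ d →
      Integrable (fun s => (N * s - k) * G.eval s) (betaPrime N k) := by
    intro G hG
    refine (integrable_eval_betaPrime hN k ((C N * X - C (k : ℝ)) * G) ?_).congr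
      (ae_of_all _ fun s => by
        simp only [eval_mul, eval_sub, eval_C, eval_X])
    have h : ((C N * X - C (k : ℝ)) * G).natDegree ≤ 1 + d :=
      natDegree_mul_le_of_le (by compute_degree) hG
    have h' : ((((C N * X - C (k : ℝ)) * G).natDegree : ℕ) : ℝ) ≤ 1 + d := by exact_mod_cast h
    linarith
  have hi2 : ∀ G : ℝ[X], G.natDegree ≤ d →
      Integrable (fun s => s * (1 + s) * (derivative G).eval s) (betaPrime N k) := by
    intro G hG
    refine (integrable_eval_betaPrime hN k (X * (1 + X) * derivative G) ?_).congr
      (ae_of_all _ fun s => by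
        simp only [eval_mul, eval_add, eval_one, eval_X])
    rcases Nat.eq_zero_or_pos G.natDegree with h0 | h0
    · rw [derivative_of_natDegree_zero h0]
      simp; linarith
    have h : (X * (1 + X) * derivative G).natDegree ≤ 2 + (d - 1) :=
      natDegree_mul_le_of_le (by compute_degree) ((natDegree_derivative_le G).trans (by omega))
    have h2 : (X * (1 + X) * derivative G).natDegree ≤ 1 + d := by omega
    have h' : (((X * (1 + X) * derivative G).natDegree : ℕ) : ℝ) ≤ 1 + d := by exact_mod_cast h2
    linarith
  refine induction_with_natDegree_le
    (fun F => ∫ s, (N * s - k) * F.eval s ∂betaPrime N k =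
      ∫ s, s * (1 + s) * (derivative F).eval s ∂betaPrime N k) d (by simp) ?_ ?_ F hF
  · intro j r _ hj
    have hjd : (j : ℝ) ≤ d := by exact_mod_cast hj
    have i0 := integrable_pow_betaPrime hN k (j := j) (by linarith)
    have i1 := integrable_pow_betaPrime hN k (j := j + 1) (by push_cast; linarith)
    have hl : ∀ s : ℝ, (N * s - k) * (C r * X ^ j).eval s = r * N * s ^ (j + 1) - r * k * s ^ j := by
      intro s
      simp only [eval_mul, eval_C, eval_pow, eval_X]; ring
    have hr : ∀ s : ℝ, s * (1 + s) * (derivative (C r * X ^ j)).eval s =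
        r * j * s ^ j + r * j * s ^ (j + 1) := by
      intro s
      rcases j with _ | j
      · simp
      · simp only [derivative_C_mul_X_pow, eval_mul, eval_C, eval_pow, eval_X,
          Nat.add_sub_cancel]
        ring
    simp_rw [hl, hr]
    rw [integral_sub (i1.const_mul _) (i0.const_mul _), integral_add (i0.const_mul _)
      (i1.const_mul _), integral_const_mul, integral_const_mul, integral_const_mul,
      integral_const_mul, integral_pow_betaPrime hN k (j := j) (by linarith),
      integral_pow_betaPrime hN k (j := j + 1) (by push_cast; linarith), ascPochhammer_succ_eval]
    have hg : Real.Gamma (N + 1 - j) = (N - j) * Real.Gamma (N + 1 - ((j + 1 : ℕ) : ℝ)) := by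
      push_cast
      rw [show N + 1 - ((j : ℝ) + 1) = N - j by ring, ← Real.Gamma_add_one (by linarith)]
      ring_nf
    rw [hg]
    ring
  · intro f g hfg hg hf' hg'
    have hfd : f.natDegree ≤ d := hfg.le.trans hg
    have e : ∀ s : ℝ, s * (1 + s) * ((derivative f).eval s + (derivative g).eval s) =
        s * (1 + s) * (derivative f).eval s + s * (1 + s) * (derivative g).eval s :=
      fun s => mul_add _ _ _
    simp only [eval_add, derivative_add, mul_add (N * _ - _), e]
    rw [integral_add (hi1 f hfd) (hi1 g hg), integral_add (hi2 f hfd) (hi2 g hg), hf', hg']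

/-- The moment of order `j` of the beta prime distribution about its mean `k / N`. -/
noncomputable def bpMoment (N : ℝ) (k j : ℕ) : ℝ := ∫ s, (s - k / N) ^ j ∂betaPrime N k

lemma integrable_central_betaPrime {N : ℝ} (hN : 0 < N) (k : ℕ) (a : ℝ) {j : ℕ}
    (hj : (j : ℝ) < N + 1) : Integrable (fun s => (s - a) ^ j) (betaPrime N k) := by
  refine (integrable_eval_betaPrime hN k ((X - C a) ^ j) ?_).congr
    (ae_of_all _ fun s => by simp only [eval_pow, eval_sub, eval_X, eval_C])
  rw [natDegree_pow, natDegree_X_sub_C, mul_one]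
  exact hj

lemma bpMoment_zero {N : ℝ} (hN : 0 < N) (k : ℕ) : bpMoment N k 0 = 1 := by
  have := integral_pow_betaPrime hN k (j := 0) (by push_cast; linarith)
  have hG : Real.Gamma (N + 1) ≠ 0 := (Real.Gamma_pos_of_pos (by positivity)).ne'
  simpa [bpMoment, hG] using this

lemma bpMoment_one {N : ℝ} (hN : 0 < N) (k : ℕ) : bpMoment N k 1 = 0 := by
  have h := integral_betaPrime_stein hN k 0 (by simpa using hN) 1 (by simp)
  simp only [eval_one, mul_one, derivative_one, eval_zero, mul_zero, integral_zero] at h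
  have e : ∀ s : ℝ, N * s - k = N * (s - k / N) := fun s => by field_simp
  simp_rw [e] at h
  rw [integral_const_mul] at h
  simpa [bpMoment, hN.ne'] using h

/-- Recursion for the moments about the mean `a = k / N`, from the Stein identity for
`(s - a) ^ (j + 1)` and the expansion of `s (1 + s)` at `a`. -/
lemma bpMoment_add_two {N : ℝ} (hN : 0 < N) (k j : ℕ) (hj : (j : ℝ) + 1 < N) :
    (N - (j + 1)) * bpMoment N k (j + 2) = (j + 1) *
      (k / N * (1 + k / N) * bpMoment N k j + (1 + 2 * (k / N)) * bpMoment N k (j + 1)) := by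
  have h := integral_betaPrime_stein hN k (j + 1) (by push_cast; linarith) ((X - C (k / N)) ^ (j + 1))
    (by rw [natDegree_pow, natDegree_X_sub_C, mul_one])
  set a : ℝ := k / N with ha
  have i0 := integrable_central_betaPrime hN k a (j := j) (by linarith)
  have i1 := integrable_central_betaPrime hN k a (j := j + 1) (by push_cast; linarith)
  have i2 := integrable_central_betaPrime hN k a (j := j + 2) (by push_cast; linarith)
  have hk : (k : ℝ) = N * a := by rw [ha]; field_simp
  have hl : ∀ s : ℝ, (N * s - k) * ((X - C a) ^ (j + 1)).eval s = N * (s - a) ^ (j + 2) := by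
    intro s
    simp only [eval_pow, eval_sub, eval_X, eval_C]
    rw [hk]; ring
  have hr : ∀ s : ℝ, s * (1 + s) * (derivative ((X - C a) ^ (j + 1))).eval s =
      (j + 1) * (a * (1 + a)) * (s - a) ^ j + (j + 1) * (1 + 2 * a) * (s - a) ^ (j + 1) +
        (j + 1) * (s - a) ^ (j + 2) := by
    intro s
    rw [derivative_X_sub_C_pow]
    simp only [eval_mul, eval_pow, eval_sub, eval_X, eval_C,
      Nat.add_sub_cancel, Nat.cast_add, Nat.cast_one]
    ring
  simp_rw [hl, hr] at h
  have i01 : Integrable (fun s => (j + 1) * (a * (1 + a)) * (s - a) ^ j +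
      (j + 1) * (1 + 2 * a) * (s - a) ^ (j + 1)) (betaPrime N k) :=
    (i0.const_mul _).add (i1.const_mul _)
  rw [integral_add i01 (i2.const_mul _),
    integral_add (i0.const_mul _) (i1.const_mul _)] at h
  simp only [integral_const_mul] at h
  simp only [bpMoment, ← ha]
  linear_combination h

/-- The moments about the mean are `O(N ^ (-j / 2))`, with an explicit dependence on the mean. As in
`exists_abs_nbMoment_le`, the number `ρ` stands for `N ^ (-1 / 2)`. -/
lemma exists_abs_bpMoment_le (j : ℕ) : ∃ C : ℝ, 0 ≤ C ∧
    ∀ (N ρ : ℝ) (k : ℕ), 0 < ρ → ρ ≤ 1 → N * ρ ^ 2 = 1 → 2 * (j : ℝ) ≤ N →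
      |bpMoment N k j| ≤ C * (1 + k / N) ^ j * ρ ^ j := by
  induction j using Nat.strong_induction_on with
  | _ j ih =>
    have hpos : ∀ N ρ : ℝ, 0 < ρ → N * ρ ^ 2 = 1 → 0 < N := fun N ρ hρ hN => by
      by_contra hneg
      nlinarith [sq_nonneg ρ]
    rcases j with _ | _ | j
    · refine ⟨1, zero_le_one, fun N ρ k hρ _ hN _ => ?_⟩
      rw [bpMoment_zero (hpos N ρ hρ hN)]
      simp
    · refine ⟨0, le_rfl, fun N ρ k hρ _ hN _ => ?_⟩
      rw [bpMoment_one (hpos N ρ hρ hN)]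
      simp
    · obtain ⟨C0, hC0, h0⟩ := ih j (by omega)
      obtain ⟨C1, hC1, h1⟩ := ih (j + 1) (by omega)
      refine ⟨2 * (j + 1) * (C0 + 2 * C1), by positivity, fun N ρ k hρ hρ1 hN hjN => ?_⟩
      have hN0 := hpos N ρ hρ hN
      push_cast at hjN
      have b0 := h0 N ρ k hρ hρ1 hN (by linarith)
      have b1 := h1 N ρ k hρ hρ1 hN (by push_cast; linarith)
      have hrec := bpMoment_add_two hN0 k j (by linarith)
      set a : ℝ := k / N with ha
      have ha0 : 0 ≤ a := by positivity
      have b1' : |bpMoment N k (j + 1)| ≤ C1 * (1 + a) ^ (j + 1) * ρ ^ j :=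
        b1.trans (mul_le_mul_of_nonneg_left
          (pow_le_pow_of_le_one hρ.le hρ1 (by omega)) (by positivity))
      have hin : |a * (1 + a) * bpMoment N k j + (1 + 2 * a) * bpMoment N k (j + 1)| ≤
          (C0 + 2 * C1) * (1 + a) ^ (j + 2) * ρ ^ j := by
        refine (abs_add_le _ _).trans ?_
        rw [abs_mul (a * (1 + a)), abs_mul (1 + 2 * a), abs_of_nonneg (by positivity : 0 ≤ a * (1 + a)),
          abs_of_nonneg (by positivity : 0 ≤ 1 + 2 * a)]
        calc a * (1 + a) * |bpMoment N k j| + (1 + 2 * a) * |bpMoment N k (j + 1)|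
            ≤ ((1 + a) * (1 + a)) * (C0 * (1 + a) ^ j * ρ ^ j) +
              (2 * (1 + a)) * (C1 * (1 + a) ^ (j + 1) * ρ ^ j) := by
              gcongr <;> linarith
          _ = _ := by ring
      have hhalf : N / 2 * |bpMoment N k (j + 2)| ≤
          (j + 1) * ((C0 + 2 * C1) * (1 + a) ^ (j + 2) * ρ ^ j) := by
        calc N / 2 * |bpMoment N k (j + 2)| ≤ (N - (j + 1)) * |bpMoment N k (j + 2)| := by
              gcongr; linarith
          _ = |(N - (j + 1)) * bpMoment N k (j + 2)| := by
              rw [abs_mul, abs_of_nonneg (by linarith : 0 ≤ N - ((j : ℝ) + 1))]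
          _ ≤ _ := by
              rw [hrec, abs_mul, abs_of_nonneg (by positivity : (0 : ℝ) ≤ (j : ℝ) + 1)]
              gcongr
      calc |bpMoment N k (j + 2)| = 2 * ρ ^ 2 * (N / 2 * |bpMoment N k (j + 2)|) := by
            linear_combination -(|bpMoment N k (j + 2)|) * hN
        _ ≤ 2 * ρ ^ 2 * ((j + 1) * ((C0 + 2 * C1) * (1 + a) ^ (j + 2) * ρ ^ j)) := by gcongr
        _ = _ := by ring

/-! ### The normalized operator on functions of polynomial growth -/

/-- The operator for `γ = 1` and without the Stancu shift, with a real parameter `N`. -/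
noncomputable def opL (N : ℝ) (g : ℝ → ℝ) (w : ℝ) : ℝ :=
  ∑' k : ℕ, nb N k w * ∫ s, g s ∂betaPrime N k

/-- The factor by which the operator multiplies the coefficient of degree `j`, namely
`N (N + 1) ⋯ (N + j - 1) / (N (N - 1) ⋯ (N - j + 1))`. -/
noncomputable def leadFactor (N : ℝ) (j : ℕ) : ℝ :=
  (ascPochhammer ℝ j).eval N * (Real.Gamma (N + 1 - j) / Real.Gamma (N + 1))

lemma exists_integral_eval_betaPrime {N : ℝ} (hN : 0 < N) {j : ℕ} (hj : (j : ℝ) ≤ N) (F : ℝ[X])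
    (hF : F.natDegree ≤ j) : ∃ G : ℝ[X], G.natDegree ≤ j ∧
      G.coeff j = F.coeff j * (Real.Gamma (N + 1 - j) / Real.Gamma (N + 1)) ∧
      ∀ k : ℕ, ∫ s, F.eval s ∂betaPrime N k = G.eval (k : ℝ) := by
  refine ⟨∑ i ∈ Finset.range (j + 1), C (F.coeff i *
    (Real.Gamma (N + 1 - i) / Real.Gamma (N + 1))) * ascPochhammer ℝ i, ?_, ?_, fun k => ?_⟩
  · refine natDegree_sum_le_of_forall_le _ _ fun i hi => ?_
    refine (natDegree_C_mul_le _ _).trans ?_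
    rw [ascPochhammer_natDegree]
    exact Finset.mem_range_succ_iff.mp hi
  · rw [finsetSum_coeff, Finset.sum_range_succ, Finset.sum_eq_zero]
    · have h := (monic_ascPochhammer ℝ j).coeff_natDegree
      rw [ascPochhammer_natDegree] at h
      rw [coeff_C_mul, h]
      ring
    · intro i hi
      rw [coeff_C_mul, coeff_eq_zero_of_natDegree_lt (p := ascPochhammer ℝ i)
        (by rw [ascPochhammer_natDegree]; exact Finset.mem_range.mp hi), mul_zero]
  · have hlt : ∀ i ∈ Finset.range (j + 1), (i : ℝ) < N + 1 := fun i hi => by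
      have : (i : ℝ) ≤ j := by exact_mod_cast Finset.mem_range_succ_iff.mp hi
      linarith
    simp_rw [eval_eq_sum_range' (Nat.lt_succ_of_le hF)]
    rw [integral_finsetSum _ fun i hi =>
      (integrable_pow_betaPrime hN k (hlt i hi)).const_mul _, eval_finsetSum]
    refine Finset.sum_congr rfl fun i hi => ?_
    rw [integral_const_mul, integral_pow_betaPrime hN k (hlt i hi), eval_mul, eval_C]
    ring

/-- The operator maps polynomials of degree at most `j` to polynomials of degree at most `j`. -/
lemma exists_hasSum_opL_eval {N : ℝ} (hN : 0 < N) {j : ℕ} (hj : (j : ℝ) ≤ N) (F : ℝ[X])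
    (hF : F.natDegree ≤ j) : ∃ Q : ℝ[X], Q.natDegree ≤ j ∧
      Q.coeff j = F.coeff j * leadFactor N j ∧ ∀ w : ℝ, 0 ≤ w →
        HasSum (fun k : ℕ => nb N k w * ∫ s, F.eval s ∂betaPrime N k) (Q.eval w) := by
  obtain ⟨G, hG1, hG2, hG3⟩ := exists_integral_eval_betaPrime hN hj F hF
  obtain ⟨Q, hQ1, hQ2, hQ3⟩ := exists_hasSum_nb_mul_eval hN j G hG1
  refine ⟨Q, hQ1, ?_, fun w hw => ?_⟩
  · rw [hQ2, hG2, leadFactor]; ring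
  · simp_rw [hG3]
    exact hQ3 w hw

lemma leadFactor_succ {N : ℝ} {j : ℕ} (hj : (j : ℝ) < N) :
    leadFactor N (j + 1) = leadFactor N j * ((N + j) / (N - j)) := by
  have hg : Real.Gamma (N + 1 - j) = (N - j) * Real.Gamma (N + 1 - ((j + 1 : ℕ) : ℝ)) := by
    push_cast
    rw [show N + 1 - ((j : ℝ) + 1) = N - j by ring, ← Real.Gamma_add_one (by linarith)]
    ring_nf
  have h0 : N - j ≠ 0 := by linarith
  rw [leadFactor, leadFactor, hg, ascPochhammer_succ_eval]
  field_simp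

lemma tendsto_leadFactor (j : ℕ) : Tendsto (fun N => leadFactor N j) atTop (𝓝 1) := by
  induction j with
  | zero =>
    refine tendsto_const_nhds.congr' ?_
    filter_upwards [eventually_gt_atTop 0] with N hN
    have : Real.Gamma (N + 1) ≠ 0 := (Real.Gamma_pos_of_pos (by linarith)).ne'
    simp [leadFactor, this]
  | succ j ih =>
    have h : Tendsto (fun N : ℝ => 1 + 2 * j / (N - j)) atTop (𝓝 (1 + 0)) :=
      tendsto_const_nhds.add (tendsto_const_nhds.div_atTop
        (tendsto_atTop_add_const_right _ _ tendsto_id))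
    have h2 := ih.mul h
    rw [add_zero, mul_one] at h2
    refine h2.congr' ?_
    filter_upwards [eventually_gt_atTop (j : ℝ)] with N hN
    have h0 : N - j ≠ 0 := by linarith
    rw [leadFactor_succ hN]
    congr 1
    field_simp
    ring

lemma integrable_betaPrime_of_le {N : ℝ} (hN : 0 < N) {d : ℕ} (hd : (d : ℝ) ≤ N) {g : ℝ → ℝ}
    (hg : Continuous g) {A : ℝ} (hA : ∀ s, 0 ≤ s → |g s| ≤ A * (1 + s) ^ d) (k : ℕ) :
    Integrable g (betaPrime N k) := by
  have hi : Integrable (fun s => A * (1 + s) ^ d) (betaPrime N k) := by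
    have := (integrable_central_betaPrime hN k (-1) (j := d) (by linarith)).const_mul A
    refine this.congr (ae_of_all _ fun s => ?_)
    simp only
    ring
  refine hi.mono' hg.aestronglyMeasurable ?_
  filter_upwards [ae_nonneg_betaPrime N k] with s hs
  exact hA s hs

lemma summable_opL_abs {N : ℝ} (hN : 0 < N) {d : ℕ} (hd : (d : ℝ) ≤ N) {g : ℝ → ℝ}
    (hg : Continuous g) {A : ℝ} (hA : ∀ s, 0 ≤ s → |g s| ≤ A * (1 + s) ^ d) {w : ℝ} (hw : 0 ≤ w) :
    Summable fun k : ℕ => nb N k w * ∫ s, |g s| ∂betaPrime N k := by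
  have hF : (C A * (X + C 1) ^ d).natDegree ≤ d :=
    (natDegree_C_mul_le _ _).trans (by rw [natDegree_pow, natDegree_X_add_C, mul_one])
  obtain ⟨Q, -, -, hQ⟩ := exists_hasSum_opL_eval hN hd _ hF
  refine Summable.of_nonneg_of_le
    (fun k => mul_nonneg (nb_nonneg hN hw k) (integral_nonneg fun s => abs_nonneg _))
    (fun k => ?_) (hQ w hw).summable
  refine mul_le_mul_of_nonneg_left ?_ (nb_nonneg hN hw k)
  refine integral_mono_ae (integrable_betaPrime_of_le hN hd hg hA k).abs
    (integrable_eval_betaPrime hN k _ ?_) ?_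
  · have : ((C A * (X + C 1) ^ d).natDegree : ℝ) ≤ d := by exact_mod_cast hF
    linarith
  · filter_upwards [ae_nonneg_betaPrime N k] with s hs
    refine (hA s hs).trans_eq ?_
    simp only [eval_mul, eval_pow, eval_add, eval_X, eval_C, add_comm]

lemma summable_opL {N : ℝ} (hN : 0 < N) {d : ℕ} (hd : (d : ℝ) ≤ N) {g : ℝ → ℝ}
    (hg : Continuous g) {A : ℝ} (hA : ∀ s, 0 ≤ s → |g s| ≤ A * (1 + s) ^ d) {w : ℝ} (hw : 0 ≤ w) :
    Summable fun k : ℕ => nb N k w * ∫ s, g s ∂betaPrime N k := by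
  refine (summable_opL_abs hN hd hg hA hw).of_norm_bounded fun k => ?_
  rw [norm_mul, Real.norm_of_nonneg (nb_nonneg hN hw k)]
  exact mul_le_mul_of_nonneg_left (abs_integral_le_integral_abs) (nb_nonneg hN hw k)

lemma opL_add {N : ℝ} (hN : 0 < N) {d : ℕ} (hd : (d : ℝ) ≤ N) {g h : ℝ → ℝ}
    (hg : Continuous g) (hh : Continuous h) {A A' : ℝ} (hA : ∀ s, 0 ≤ s → |g s| ≤ A * (1 + s) ^ d)
    (hA' : ∀ s, 0 ≤ s → |h s| ≤ A' * (1 + s) ^ d) {w : ℝ} (hw : 0 ≤ w) :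
    opL N (fun s => g s + h s) w = opL N g w + opL N h w := by
  rw [opL, opL, opL, ← (summable_opL hN hd hg hA hw).tsum_add (summable_opL hN hd hh hA' hw)]
  congr 1
  funext k
  rw [integral_add (integrable_betaPrime_of_le hN hd hg hA k)
    (integrable_betaPrime_of_le hN hd hh hA' k), mul_add]

lemma one_le_of_mul_sq_eq_one {N ρ : ℝ} (hρ : 0 < ρ) (hρ1 : ρ ≤ 1) (hN : N * ρ ^ 2 = 1) :
    1 ≤ N := by
  by_contra hneg
  have : ρ ^ 2 ≤ 1 := pow_le_one₀ hρ.le hρ1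
  have : 0 < ρ ^ 2 := by positivity
  nlinarith

/-- The even moments about a point `u` at distance `O(N ^ (-1 / 2))` from `w` are
`O(N ^ (-m))`. The deviation `s - u` is split at the mean `k / N` of the beta prime distribution
and at the mean `w` of `k / N`. -/
lemma exists_opL_sub_pow_le (W D : ℝ) (m : ℕ) : ∃ K : ℝ, 0 ≤ K ∧
    ∀ N ρ w u : ℝ, 0 < ρ → ρ ≤ 1 → N * ρ ^ 2 = 1 → 4 * (m : ℝ) ≤ N → 0 ≤ w → w ≤ W →
      |w - u| ≤ D * ρ → opL N (fun s => (s - u) ^ (2 * m)) w ≤ K * ρ ^ (2 * m) := by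
  obtain ⟨C1, hC1, h1⟩ := exists_abs_bpMoment_le (2 * m)
  obtain ⟨C2, hC2, h2⟩ := exists_abs_nbMoment_le W (2 * m)
  set c : ℝ := 2 ^ (2 * m - 1) with hc
  have hc0 : 0 < c := by positivity
  set α : ℝ := c * (C1 * (c * (1 + |W|) ^ (2 * m)) + c * |D| ^ (2 * m)) with hα
  set β : ℝ := c * (C1 * c + c) with hβ
  refine ⟨α + β * C2, by positivity, fun N ρ w u hρ hρ1 hN hmN hw hwW hwu => ?_⟩
  have hN0 : 0 < N := lt_of_lt_of_le one_pos (one_le_of_mul_sq_eq_one hρ hρ1 hN)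
  have heven : Even (2 * m) := even_two_mul m
  have hsN : ((2 * m : ℕ) : ℝ) < N + 1 := by
    have : (0 : ℝ) ≤ m := by positivity
    push_cast; linarith
  have hint : ∀ k : ℕ, ∫ s, (s - u) ^ (2 * m) ∂betaPrime N k ≤
      α * ρ ^ (2 * m) + β * (k / N - w) ^ (2 * m) := by
    intro k
    set a : ℝ := k / N with ha
    have ha0 : 0 ≤ a := by positivity
    have hi := integrable_central_betaPrime hN0 k a hsN
    have hc1 : Integrable (fun _ : ℝ => c * (c * ((a - w) ^ (2 * m) + (w - u) ^ (2 * m))))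
        (betaPrime N k) := by
      have := (integrable_pow_betaPrime hN0 k (j := 0) (by push_cast; linarith)).const_mul
        (c * (c * ((a - w) ^ (2 * m) + (w - u) ^ (2 * m))))
      simpa using this
    have h1' : ∫ _s, (1 : ℝ) ∂betaPrime N k = 1 := by
      simpa [bpMoment] using bpMoment_zero hN0 k
    have hwu' : (w - u) ^ (2 * m) ≤ |D| ^ (2 * m) * ρ ^ (2 * m) := by
      rw [← heven.pow_abs, ← mul_pow]
      refine pow_le_pow_left₀ (abs_nonneg _) (hwu.trans ?_) _
      gcongr
      exact le_abs_self D
    have h1a : (1 + a) ^ (2 * m) ≤ c * ((1 + |W|) ^ (2 * m) + (a - w) ^ (2 * m)) := by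
      have e : 1 + a = (1 + w) + (a - w) := by ring
      rw [e]
      refine (heven.add_pow_le).trans ?_
      gcongr
      exact hwW.trans (le_abs_self W)
    have hbp : ∫ s, (s - a) ^ (2 * m) ∂betaPrime N k ≤
        C1 * (c * ((1 + |W|) ^ (2 * m) * ρ ^ (2 * m) + (a - w) ^ (2 * m))) := by
      have hb := (le_abs_self _).trans (h1 N ρ k hρ hρ1 hN (by push_cast; linarith))
      refine hb.trans ?_
      have hp1 : ρ ^ (2 * m) ≤ 1 := pow_le_one₀ hρ.le hρ1
      have hp0 : 0 ≤ (a - w) ^ (2 * m) := heven.pow_nonneg _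
      calc C1 * (1 + a) ^ (2 * m) * ρ ^ (2 * m)
          ≤ C1 * (c * ((1 + |W|) ^ (2 * m) + (a - w) ^ (2 * m))) * ρ ^ (2 * m) := by gcongr
        _ = C1 * (c * ((1 + |W|) ^ (2 * m) * ρ ^ (2 * m) + (a - w) ^ (2 * m) * ρ ^ (2 * m))) := by
            ring
        _ ≤ C1 * (c * ((1 + |W|) ^ (2 * m) * ρ ^ (2 * m) + (a - w) ^ (2 * m) * 1)) := by gcongr
        _ = _ := by rw [mul_one]
    calc ∫ s, (s - u) ^ (2 * m) ∂betaPrime N k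
        ≤ ∫ s, (c * (s - a) ^ (2 * m) + c * (c * ((a - w) ^ (2 * m) + (w - u) ^ (2 * m))))
            ∂betaPrime N k := by
          refine integral_mono (integrable_central_betaPrime hN0 k u hsN)
            ((hi.const_mul c).add hc1) fun s => ?_
          have e : s - u = (s - a) + ((a - w) + (w - u)) := by ring
          simp only
          rw [e, ← mul_add]
          refine (heven.add_pow_le).trans ?_
          gcongr
          exact heven.add_pow_le
      _ = c * ∫ s, (s - a) ^ (2 * m) ∂betaPrime N k +
            c * (c * ((a - w) ^ (2 * m) + (w - u) ^ (2 * m))) := by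
          rw [integral_add (hi.const_mul c) hc1, integral_const_mul]
          congr 1
          have := integral_const_mul (μ := betaPrime N k)
            (c * (c * ((a - w) ^ (2 * m) + (w - u) ^ (2 * m)))) (fun _ => (1 : ℝ))
          simp only [mul_one, h1'] at this
          exact this
      _ ≤ c * (C1 * (c * ((1 + |W|) ^ (2 * m) * ρ ^ (2 * m) + (a - w) ^ (2 * m)))) +
            c * (c * ((a - w) ^ (2 * m) + |D| ^ (2 * m) * ρ ^ (2 * m))) := by gcongr
      _ = α * ρ ^ (2 * m) + β * (a - w) ^ (2 * m) := by rw [hα, hβ]; ring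
  have hs1 : Summable fun k : ℕ => nb N k w * ∫ s, (s - u) ^ (2 * m) ∂betaPrime N k := by
    obtain ⟨Q, -, -, hQ⟩ := exists_hasSum_opL_eval hN0 (j := 2 * m)
      (by have : (0 : ℝ) ≤ m := by positivity
          push_cast; linarith) ((X - C u) ^ (2 * m))
      (by rw [natDegree_pow, natDegree_X_sub_C, mul_one])
    have := (hQ w hw).summable
    simpa only [eval_pow, eval_sub, eval_X, eval_C] using this
  have hs2 := ((hasSum_nb hN0 hw).mul_left (α * ρ ^ (2 * m))).add
    ((summable_nb_central hN0 hw (2 * m)).hasSum.mul_left β)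
  calc opL N (fun s => (s - u) ^ (2 * m)) w
      ≤ ∑' k : ℕ, (α * ρ ^ (2 * m) * nb N k w + β * (nb N k w * (k / N - w) ^ (2 * m))) := by
        refine hs1.tsum_le_tsum (fun k => ?_) hs2.summable
        calc nb N k w * ∫ s, (s - u) ^ (2 * m) ∂betaPrime N k
            ≤ nb N k w * (α * ρ ^ (2 * m) + β * (k / N - w) ^ (2 * m)) :=
              mul_le_mul_of_nonneg_left (hint k) (nb_nonneg hN0 hw k)
          _ = _ := by ring
    _ = α * ρ ^ (2 * m) * 1 + β * nbMoment N w (2 * m) := hs2.tsum_eq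
    _ ≤ α * ρ ^ (2 * m) * 1 + β * (C2 * ρ ^ (2 * m)) := by
        gcongr
        exact (le_abs_self _).trans (h2 N ρ w hρ hρ1 hN hw hwW)
    _ = _ := by ring

/-! ### Complex extension and Cauchy estimates -/

/-- Holomorphic extension of the negative binomial weight to the right half plane. -/
noncomputable def cnb (N : ℝ) (k : ℕ) (z : ℂ) : ℂ :=
  ((Real.Gamma (N + k) / (Real.Gamma (k + 1) * Real.Gamma N) : ℝ) : ℂ) *
    ((z / (1 + z)) ^ k * (1 + z) ^ ((-N : ℝ) : ℂ))

lemma cnb_ofReal (N : ℝ) (k : ℕ) {w : ℝ} (hw : 0 ≤ w) : cnb N k w = (nb N k w : ℂ) := by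
  have h1w : 0 < 1 + w := by linarith
  have e : (w ^ k / (1 + w) ^ (N + k) : ℝ) = (w / (1 + w)) ^ k * (1 + w) ^ (-N) := by
    rw [Real.rpow_add h1w, Real.rpow_natCast, Real.rpow_neg h1w.le, div_pow]
    field_simp
  rw [cnb, nb, e]
  push_cast
  rw [Complex.ofReal_cpow h1w.le]
  push_cast
  rfl

lemma norm_cnb {N : ℝ} (hN : 0 < N) (k : ℕ) (z : ℂ) :
    ‖cnb N k z‖ = Real.Gamma (N + k) / (Real.Gamma (k + 1) * Real.Gamma N) *
      ((‖z‖ / ‖1 + z‖) ^ k * ‖1 + z‖ ^ (-N)) := by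
  have h1 : 0 < Real.Gamma (N + k) := Real.Gamma_pos_of_pos (by positivity)
  have h2 : 0 < Real.Gamma ((k : ℝ) + 1) := Real.Gamma_pos_of_pos (by positivity)
  have h3 : 0 < Real.Gamma N := Real.Gamma_pos_of_pos hN
  rw [cnb, norm_mul, norm_mul, norm_pow, norm_div, Complex.norm_real,
    Real.norm_of_nonneg (by positivity), Complex.norm_cpow_real]

lemma norm_lt_norm_one_add {z : ℂ} (hz : 0 < z.re) : ‖z‖ < ‖1 + z‖ := by
  rw [Complex.norm_def, Complex.norm_def]
  refine Real.sqrt_lt_sqrt (Complex.normSq_nonneg _) ?_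
  simp only [Complex.normSq_apply, Complex.add_re, Complex.add_im, Complex.one_re, Complex.one_im]
  nlinarith

lemma one_le_norm_one_add {z : ℂ} (hz : 0 < z.re) : 1 ≤ ‖1 + z‖ := by
  have := (Complex.re_le_norm (1 + z))
  simp only [Complex.add_re, Complex.one_re] at this
  linarith

/-- Up to a factor independent of `k`, the modulus of the extended weight at `z` is again a weight,
at the real point `‖z‖ / (‖1 + z‖ - ‖z‖)`. -/
lemma norm_cnb_eq {N : ℝ} (hN : 0 < N) (k : ℕ) {z : ℂ} (hz : 0 < z.re) :
    ‖cnb N k z‖ = (‖1 + z‖ - ‖z‖) ^ (-N) * nb N k (‖z‖ / (‖1 + z‖ - ‖z‖)) := by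
  have hD : 0 < ‖1 + z‖ - ‖z‖ := sub_pos.mpr (norm_lt_norm_one_add hz)
  have h1 : 0 < ‖1 + z‖ := lt_of_lt_of_le one_pos (one_le_norm_one_add hz)
  rw [norm_cnb hN k z, nb]
  have e : 1 + ‖z‖ / (‖1 + z‖ - ‖z‖) = ‖1 + z‖ / (‖1 + z‖ - ‖z‖) := by
    field_simp; ring
  rw [e, Real.rpow_add (by positivity), Real.rpow_natCast, Real.rpow_neg h1.le,
    Real.rpow_neg hD.le, Real.div_rpow h1.le hD.le]
  have h2 : ‖1 + z‖ ^ N ≠ 0 := (Real.rpow_pos_of_pos h1 N).ne'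
  have h3 : (‖1 + z‖ - ‖z‖) ^ N ≠ 0 := (Real.rpow_pos_of_pos hD N).ne'
  set D := ‖1 + z‖ - ‖z‖
  rw [div_pow, div_pow, div_pow]
  field_simp

lemma inv_le_norm_sub_norm {z : ℂ} {Z : ℝ} (hz : 0 < z.re) (hZ : ‖z‖ ≤ Z) :
    (1 + 2 * Z)⁻¹ ≤ ‖1 + z‖ - ‖z‖ := by
  have h0 := norm_nonneg z
  have h1 : ‖1 + z‖ ^ 2 - ‖z‖ ^ 2 = 1 + 2 * z.re := by
    rw [Complex.sq_norm, Complex.sq_norm]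
    simp only [Complex.normSq_apply, Complex.add_re, Complex.add_im, Complex.one_re,
      Complex.one_im]
    ring
  have h2 : ‖1 + z‖ ≤ 1 + ‖z‖ := (norm_add_le _ _).trans (by simp)
  have h3 := norm_lt_norm_one_add hz
  rw [inv_le_iff_one_le_mul₀ (by linarith)]
  nlinarith

/-- The half disc `{z | 0 < Re z, ‖z‖ < Z}`. -/
def halfDisc (Z : ℝ) : Set ℂ := {z | 0 < z.re} ∩ Metric.ball 0 Z

lemma isOpen_halfDisc (Z : ℝ) : IsOpen (halfDisc Z) :=
  (isOpen_lt continuous_const Complex.continuous_re).inter Metric.isOpen_ball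

/-- A summable majorant on a half disc: there the modulus of `z / (1 + z)` is at most `w / (1 + w)`
for the real point `w = Z (1 + 2 Z)`. -/
lemma norm_cnb_le {N : ℝ} (hN : 0 < N) (k : ℕ) {Z : ℝ} {z : ℂ} (hz : z ∈ halfDisc Z) :
    ‖cnb N k z‖ ≤ (1 + Z * (1 + 2 * Z)) ^ N * nb N k (Z * (1 + 2 * Z)) := by
  obtain ⟨hz, hzZ⟩ := hz
  have hz : 0 < z.re := hz
  have hzZ : ‖z‖ < Z := by simpa using hzZ
  have hz0 : 0 ≤ ‖z‖ := norm_nonneg z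
  have hZ : 0 < Z := lt_of_le_of_lt (norm_nonneg z) hzZ
  have h1 := one_le_norm_one_add hz
  have hD := inv_le_norm_sub_norm hz hzZ.le
  set w := Z * (1 + 2 * Z) with hw
  have hw0 : 0 < w := by positivity
  have hq : ‖z‖ / ‖1 + z‖ ≤ w / (1 + w) := by
    rw [div_le_div_iff₀ (by linarith) (by linarith)]
    have h2 : ‖z‖ ≤ w * (‖1 + z‖ - ‖z‖) := by
      calc ‖z‖ ≤ Z := hzZ.le
        _ = w * (1 + 2 * Z)⁻¹ := by rw [hw]; field_simp
        _ ≤ _ := by gcongr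
    nlinarith
  have g1 : 0 < Real.Gamma (N + k) := Real.Gamma_pos_of_pos (by positivity)
  have g2 : 0 < Real.Gamma ((k : ℝ) + 1) := Real.Gamma_pos_of_pos (by positivity)
  have g3 : 0 < Real.Gamma N := Real.Gamma_pos_of_pos hN
  have hr : 0 < (1 + w) ^ N := Real.rpow_pos_of_pos (by linarith) N
  rw [norm_cnb hN k z, nb, Real.rpow_add (by linarith),
    Real.rpow_natCast]
  calc Real.Gamma (N + k) / (Real.Gamma (k + 1) * Real.Gamma N) *
        ((‖z‖ / ‖1 + z‖) ^ k * ‖1 + z‖ ^ (-N))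
      ≤ Real.Gamma (N + k) / (Real.Gamma (k + 1) * Real.Gamma N) * ((w / (1 + w)) ^ k * 1) := by
        gcongr
        exact Real.rpow_le_one_of_one_le_of_nonpos h1 (by linarith)
    _ = _ := by
        rw [div_pow]
        field_simp

/-- Holomorphic extension of `opL N g` to the right half plane. -/
noncomputable def copL (N : ℝ) (g : ℝ → ℝ) (z : ℂ) : ℂ :=
  ∑' k : ℕ, cnb N k z * ((∫ s, g s ∂betaPrime N k : ℝ) : ℂ)

lemma differentiableOn_cnb (N : ℝ) (k : ℕ) (Z : ℝ) : DifferentiableOn ℂ (cnb N k) (halfDisc Z) := by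
  intro z hz
  have hz : 0 < z.re := hz.1
  have h1 : 1 + z ≠ 0 := norm_pos_iff.mp (lt_of_lt_of_le one_pos (one_le_norm_one_add hz))
  have hs : 1 + z ∈ Complex.slitPlane := Or.inl (by simp; linarith)
  have hd : DifferentiableAt ℂ (fun z : ℂ => 1 + z) z := by fun_prop
  exact (((differentiableAt_id.div hd h1).pow k).mul
    (hd.cpow_const hs)).const_mul _ |>.differentiableWithinAt

section

variable {N : ℝ} {d : ℕ} {g : ℝ → ℝ} {A : ℝ}

lemma differentiableOn_copL (hN : 0 < N) (hd : (d : ℝ) ≤ N) (hg : Continuous g)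
    (hA : ∀ s, 0 ≤ s → |g s| ≤ A * (1 + s) ^ d) (Z : ℝ) :
    DifferentiableOn ℂ (copL N g) (halfDisc Z) := by
  by_cases hZ : 0 ≤ Z
  · refine Complex.differentiableOn_tsum_of_summable_norm
      ((summable_opL_abs hN hd hg hA (w := Z * (1 + 2 * Z)) (by positivity)).mul_left
        ((1 + Z * (1 + 2 * Z)) ^ N))
      (fun k => (differentiableOn_cnb N k Z).mul_const _) (isOpen_halfDisc Z) fun k z hz => ?_
    rw [norm_mul, Complex.norm_real, ← mul_assoc]
    exact mul_le_mul (norm_cnb_le hN k hz) abs_integral_le_integral_abs (norm_nonneg _)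
      ((norm_nonneg _).trans (norm_cnb_le hN k hz))
  · intro z hz
    have : ‖z‖ < Z := by simpa using hz.2
    exact absurd ((norm_nonneg z).trans this.le) hZ

lemma copL_ofReal_re {w : ℝ} (hw : 0 ≤ w) : (copL N g w).re = opL N g w := by
  have : copL N g w = ((opL N g w : ℝ) : ℂ) := by
    rw [copL, opL, Complex.ofReal_tsum]
    congr 1
    funext k
    rw [cnb_ofReal N k hw]
    push_cast
    rfl
  rw [this, Complex.ofReal_re]

lemma norm_copL_le (hN : 0 < N) (hd : (d : ℝ) ≤ N) (hg : Continuous g)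
    (hA : ∀ s, 0 ≤ s → |g s| ≤ A * (1 + s) ^ d) {z : ℂ} (hz : 0 < z.re) :
    ‖copL N g z‖ ≤ (‖1 + z‖ - ‖z‖) ^ (-N) *
      opL N (fun s => |g s|) (‖z‖ / (‖1 + z‖ - ‖z‖)) := by
  have hD : 0 < ‖1 + z‖ - ‖z‖ := sub_pos.mpr (norm_lt_norm_one_add hz)
  have hw : 0 ≤ ‖z‖ / (‖1 + z‖ - ‖z‖) := by positivity
  refine tsum_of_norm_bounded
    ((summable_opL_abs hN hd hg hA hw).hasSum.mul_left ((‖1 + z‖ - ‖z‖) ^ (-N))) fun k => ?_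
  rw [norm_mul, Complex.norm_real, ← mul_assoc, ← norm_cnb_eq hN k hz]
  exact mul_le_mul_of_nonneg_left abs_integral_le_integral_abs (norm_nonneg _)

/-- The real part of a holomorphic function, restricted to the real line, is differentiated by
differentiating the function. -/
lemma iteratedDeriv_re_comp_ofReal {G : ℂ → ℂ} {U : Set ℂ} (hU : IsOpen U)
    (hG : DifferentiableOn ℂ G U) {f : ℝ → ℝ} (hf : ∀ y : ℝ, (y : ℂ) ∈ U → f y = (G y).re) (r : ℕ) :
    DifferentiableOn ℂ (iteratedDeriv r G) U ∧
      ∀ y : ℝ, (y : ℂ) ∈ U → iteratedDeriv r f y = (iteratedDeriv r G y).re := by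
  induction r with
  | zero => simpa using ⟨hG, hf⟩
  | succ r ih =>
    refine ⟨by rw [iteratedDeriv_succ]; exact ih.1.deriv hU, fun y hy => ?_⟩
    have hev : iteratedDeriv r f =ᶠ[𝓝 y] fun x : ℝ => (iteratedDeriv r G x).re := by
      filter_upwards [Complex.continuous_ofReal.continuousAt.preimage_mem_nhds (hU.mem_nhds hy)]
        with x hx using ih.2 x hx
    rw [iteratedDeriv_succ, iteratedDeriv_succ, hev.deriv_eq]
    exact ((ih.1.differentiableAt (hU.mem_nhds hy)).hasDerivAt.real_of_complex).deriv

lemma ofReal_mem_halfDisc {y Z : ℝ} (hy : 0 < y) (hyZ : y < Z) : (y : ℂ) ∈ halfDisc Z := by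
  refine ⟨by simpa using hy, ?_⟩
  simpa [abs_of_pos hy] using hyZ

lemma contDiffAt_opL (hN : 0 < N) (hd : (d : ℝ) ≤ N) (hg : Continuous g)
    (hA : ∀ s, 0 ≤ s → |g s| ≤ A * (1 + s) ^ d) {u : ℝ} (hu : 0 < u) (r : ℕ) :
    ContDiffAt ℝ r (opL N g) u := by
  have h := (differentiableOn_copL hN hd hg hA (u + 1)).analyticAt
    ((isOpen_halfDisc (u + 1)).mem_nhds (ofReal_mem_halfDisc hu (by linarith)))
  have h2 : ContDiffAt ℝ r (fun y : ℝ => (copL N g y).re) u :=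
    (h.contDiffAt (n := r)).real_of_complex
  refine h2.congr_of_eventuallyEq ?_
  filter_upwards [lt_mem_nhds hu] with y hy
  exact (copL_ofReal_re hy.le).symm

/-- For `z` at distance at most `ρ` from `u > 0`, the factor `‖1 + z‖ - ‖z‖` is `1 - O(ρ²)` and the
real point `‖z‖ / (‖1 + z‖ - ‖z‖)` is at distance `O(ρ)` from `u`. -/
lemma weight_point_bounds {u ρ : ℝ} (hu : 0 < u) (hρ : 0 < ρ) (hρ1 : ρ ≤ 1) (hρu : ρ ≤ u / 2)
    (hρ2 : ρ ^ 2 / u ≤ 1 / 2) {z : ℂ} (hz : ‖z - u‖ ≤ ρ) :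
    0 < z.re ∧ 1 - ρ ^ 2 / u ≤ ‖1 + z‖ - ‖z‖ ∧ |‖z‖ / (‖1 + z‖ - ‖z‖) - u| ≤ 5 * ρ := by
  have hre : |z.re - u| ≤ ρ := by
    have := (Complex.abs_re_le_norm (z - u)).trans hz
    simpa using this
  have him : |z.im| ≤ ρ := by
    have := (Complex.abs_im_le_norm (z - u)).trans hz
    simpa using this
  have hre' := abs_le.mp hre
  have ha : u / 2 ≤ z.re := by linarith
  have ha0 : 0 < z.re := by linarith
  have hb2 : z.im ^ 2 ≤ ρ ^ 2 := by
    rw [← sq_abs]; gcongr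
  have hnz : ‖z‖ ≤ z.re + ρ ^ 2 / u := by
    have h1 : ‖z‖ ^ 2 ≤ (z.re + ρ ^ 2 / u) ^ 2 := by
      rw [Complex.sq_norm, Complex.normSq_apply]
      have h2 : ρ ^ 2 ≤ 2 * z.re * (ρ ^ 2 / u) := by
        calc ρ ^ 2 = u * (ρ ^ 2 / u) := by field_simp
          _ ≤ _ := by gcongr; linarith
      nlinarith [sq_nonneg (ρ ^ 2 / u)]
    exact abs_le_of_sq_le_sq' h1 (by positivity) |>.2
  have h1z : 1 + z.re ≤ ‖1 + z‖ := by
    simpa using Complex.re_le_norm (1 + z)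
  have hD : 1 - ρ ^ 2 / u ≤ ‖1 + z‖ - ‖z‖ := by linarith
  have hD1 : ‖1 + z‖ - ‖z‖ ≤ 1 := by
    have : ‖1 + z‖ ≤ 1 + ‖z‖ := (norm_add_le _ _).trans (by simp)
    linarith
  refine ⟨ha0, hD, ?_⟩
  have hD0 : 0 < ‖1 + z‖ - ‖z‖ := by linarith
  have hzu : |‖z‖ - u| ≤ ρ := by
    have h3 := abs_norm_sub_norm_le z (u : ℂ)
    rw [Complex.norm_real, Real.norm_of_nonneg hu.le] at h3
    exact h3.trans hz
  have hzu' := abs_le.mp hzu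
  have hup : ‖z‖ / (‖1 + z‖ - ‖z‖) ≤ u + 5 * ρ := by
    rw [div_le_iff₀ hD0]
    have h4 : (u + 5 * ρ) * (1 - ρ ^ 2 / u) ≤ (u + 5 * ρ) * (‖1 + z‖ - ‖z‖) := by gcongr
    have h5 : u * (ρ ^ 2 / u) = ρ ^ 2 := by field_simp
    have h6 : ρ * (ρ ^ 2 / u) ≤ ρ * (1 / 2) := by gcongr
    nlinarith
  have hlow : ‖z‖ ≤ ‖z‖ / (‖1 + z‖ - ‖z‖) := le_div_self (norm_nonneg z) hD0 hD1
  rw [abs_le]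
  constructor <;> linarith

/-- Cauchy estimate on the disc of radius `ρ = N ^ (-1 / 2)`: on this scale the passage to complex
arguments costs only the constant factor `exp (2 / u)`. -/
lemma abs_iteratedDeriv_opL_le (hd : (d : ℝ) ≤ N) (hg : Continuous g)
    (hA : ∀ s, 0 ≤ s → |g s| ≤ A * (1 + s) ^ d) {u ρ S : ℝ} (hu : 0 < u) (hρ : 0 < ρ)
    (hρ1 : ρ ≤ 1) (hN : N * ρ ^ 2 = 1) (hρu : ρ ≤ u / 2) (hρ2 : ρ ^ 2 / u ≤ 1 / 2)
    (hS : ∀ w, 0 ≤ w → |w - u| ≤ 5 * ρ → opL N (fun s => |g s|) w ≤ S) (r : ℕ) :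
    |iteratedDeriv r (opL N g) u| ≤ r.factorial * (Real.exp (2 / u) * S) / ρ ^ r := by
  have hN0 : 0 < N := lt_of_lt_of_le one_pos (one_le_of_mul_sq_eq_one hρ hρ1 hN)
  have hG := differentiableOn_copL hN0 hd hg hA (2 * u)
  have hsub : Metric.closedBall (u : ℂ) ρ ⊆ halfDisc (2 * u) := by
    intro z hz
    have hz : ‖z - u‖ ≤ ρ := by simpa [dist_eq_norm] using hz
    refine ⟨(weight_point_bounds hu hρ hρ1 hρu hρ2 hz).1, ?_⟩
    have h3 := (le_abs_self _).trans (abs_norm_sub_norm_le z (u : ℂ))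
    rw [Complex.norm_real, Real.norm_of_nonneg hu.le] at h3
    simp only [Metric.mem_ball, dist_zero_right]
    linarith
  rw [(iteratedDeriv_re_comp_ofReal (isOpen_halfDisc (2 * u)) hG
    (fun y hy => (copL_ofReal_re (by have : 0 < y := by simpa using hy.1
                                     exact this.le)).symm) r).2 u
    (ofReal_mem_halfDisc hu (by linarith))]
  refine (Complex.abs_re_le_norm _).trans ?_
  refine Complex.norm_iteratedDeriv_le_of_forall_mem_sphere_norm_le r hρ
    (hG.diffContOnCl_ball hsub) fun z hz => ?_
  have hz : ‖z - u‖ ≤ ρ := by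
    have := Metric.sphere_subset_closedBall hz
    simpa [dist_eq_norm] using this
  obtain ⟨hre, hD, hw⟩ := weight_point_bounds hu hρ hρ1 hρu hρ2 hz
  have hD0 : 0 < ‖1 + z‖ - ‖z‖ := sub_pos.mpr (norm_lt_norm_one_add hre)
  have hw0 : 0 ≤ ‖z‖ / (‖1 + z‖ - ‖z‖) := by positivity
  refine (norm_copL_le hN0 hd hg hA hre).trans ?_
  refine mul_le_mul ?_ (hS _ hw0 hw) ?_ (Real.exp_pos _).le
  · set t := ρ ^ 2 / u with ht
    have ht0 : 0 ≤ t := by positivity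
    have hNt : N * t = 1 / u := by rw [ht, ← mul_div_assoc, hN]
    have hexp : Real.exp (-(2 * t)) ≤ 1 - t := by
      rw [Real.exp_neg, inv_le_iff_one_le_mul₀ (Real.exp_pos _)]
      nlinarith [Real.add_one_le_exp (2 * t)]
    calc (‖1 + z‖ - ‖z‖) ^ (-N) ≤ (Real.exp (-(2 * t))) ^ (-N) :=
          Real.rpow_le_rpow_of_nonpos (Real.exp_pos _) (hexp.trans hD) (by linarith)
      _ = Real.exp (2 / u) := by
          rw [← Real.exp_mul]
          congr 1
          linear_combination 2 * hNt
  · exact tsum_nonneg fun k => mul_nonneg (nb_nonneg hN0 hw0 k)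
      (integral_nonneg fun s => abs_nonneg _)

end

/-! ### Taylor expansion with Peano remainder -/

/-- A polynomial antiderivative. -/
lemma exists_derivative_eq (T : ℝ[X]) {r : ℕ} (hT : T.natDegree ≤ r) :
    ∃ P : ℝ[X], derivative P = T ∧ P.natDegree ≤ r + 1 := by
  refine ⟨∑ i ∈ Finset.range (r + 1), C (T.coeff i / (i + 1)) * X ^ (i + 1), ?_, ?_⟩
  · rw [derivative_sum]
    conv_rhs => rw [T.as_sum_range' (r + 1) (Nat.lt_succ_of_le hT)]
    refine Finset.sum_congr rfl fun i _ => ?_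
    have : (i : ℝ) + 1 ≠ 0 := by positivity
    rw [derivative_C_mul_X_pow, Nat.add_sub_cancel, ← C_mul_X_pow_eq_monomial]
    congr 2
    push_cast
    field_simp
  · refine natDegree_sum_le_of_forall_le _ _ fun i hi => ?_
    exact (natDegree_C_mul_X_pow_le _ _).trans (Finset.mem_range.mp hi)

/-- Peano form of Taylor's theorem, for a derivative of the top order that exists at the point
only. -/
lemma exists_taylor_peano_succ (r : ℕ) : ∀ {f : ℝ → ℝ} {x : ℝ}, DerivExistsAt (r + 1) f x →
    ∃ T : ℝ[X], T.natDegree ≤ r + 1 ∧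
      T.coeff (r + 1) = iteratedDeriv (r + 1) f x / (r + 1).factorial ∧
      (fun t => f t - T.eval t) =o[𝓝 x] fun t => (t - x) ^ (r + 1) := by
  induction r with
  | zero =>
    intro f x hf
    have hd : DifferentiableAt ℝ f x := by simpa using hf.2 0 rfl
    refine ⟨C (deriv f x) * X + C (f x - deriv f x * x), by compute_degree, by simp, ?_⟩
    have := hasDerivAt_iff_isLittleO.mp hd.hasDerivAt
    simp only [zero_add, pow_one]
    refine this.congr_left fun t => ?_
    simp only [eval_add, eval_mul, eval_C, eval_X, smul_eq_mul]
    ring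
  | succ r ih =>
    intro f x hf
    have hf' : DerivExistsAt (r + 1) (deriv f) x := by
      refine ⟨fun i hi => ?_, fun i hi => ?_⟩
      · have := hf.1 (i + 1) (by omega)
        rwa [iteratedDeriv_succ'] at this
      · have := hf.2 (i + 1) (by omega)
        rwa [iteratedDeriv_succ'] at this
    obtain ⟨T, hT1, hT2, hT3⟩ := ih hf'
    obtain ⟨P, hP, hPd⟩ := exists_derivative_eq T hT1
    have hdiff : ∀ᶠ y in 𝓝 x, DifferentiableAt ℝ f y := by simpa using hf.1 0 (by omega)
    obtain ⟨δ, hδ, hball⟩ := Metric.eventually_nhds_iff_ball.mp hdiff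
    refine ⟨P + C (f x - P.eval x), ?_, ?_, ?_⟩
    · rw [natDegree_add_C]; exact hPd
    · have h1 : P.coeff (r + 1 + 1) * ((r + 1 : ℕ) + 1 : ℝ) = T.coeff (r + 1) := by
        rw [← hP, coeff_derivative]
      rw [coeff_add, coeff_C_succ, add_zero, iteratedDeriv_succ', Nat.factorial_succ]
      have h2 : ((r + 1 : ℕ) + 1 : ℝ) ≠ 0 := by positivity
      rw [eq_div_of_mul_eq h2 h1, hT2]
      push_cast
      rw [div_div, mul_comm]
    · have hx : x ∈ Metric.ball x δ := Metric.mem_ball_self hδ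
      have hn : 𝓝[Metric.ball x δ] x = 𝓝 x := Metric.isOpen_ball.nhdsWithin_eq hx
      have := Convex.isLittleO_pow_succ_real (convex_ball x δ) hx
        (f := fun t => f t - P.eval t) (f' := fun t => deriv f t - T.eval t) (n := r + 1)
        (fun t ht => by
          have h2 := P.hasDerivAt t
          rw [hP] at h2
          exact ((hball t ht).hasDerivAt.sub h2).hasDerivWithinAt)
        (by rw [hn]; exact hT3)
      rw [hn] at this
      refine this.congr_left fun t => ?_
      rw [eval_add, eval_C]
      ring

lemma exists_taylor_peano (r : ℕ) {f : ℝ → ℝ} {x : ℝ} (hc : ContinuousAt f x)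
    (hf : DerivExistsAt r f x) : ∃ T : ℝ[X], T.natDegree ≤ r ∧
      T.coeff r = iteratedDeriv r f x / r.factorial ∧
      (fun t => f t - T.eval t) =o[𝓝 x] fun t => (t - x) ^ r := by
  rcases r with _ | r
  · refine ⟨C (f x), by simp, by simp, ?_⟩
    simp only [eval_C, pow_zero]
    rw [Asymptotics.isLittleO_one_iff]
    simpa using hc.sub_const (f x)
  · exact exists_taylor_peano_succ r hf

lemma exists_abs_eval_le (T : ℝ[X]) {r d : ℕ} (hT : T.natDegree ≤ r) (hrd : r ≤ d) :
    ∃ A : ℝ, 0 ≤ A ∧ ∀ t : ℝ, 0 ≤ t → |T.eval t| ≤ A * (1 + t) ^ d := by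
  refine ⟨∑ i ∈ Finset.range (r + 1), |T.coeff i|, Finset.sum_nonneg fun _ _ => abs_nonneg _,
    fun t ht => ?_⟩
  rw [eval_eq_sum_range' (Nat.lt_succ_of_le hT), Finset.sum_mul]
  refine (Finset.abs_sum_le_sum_abs _ _).trans (Finset.sum_le_sum fun i hi => ?_)
  rw [abs_mul, abs_pow, abs_of_nonneg ht]
  gcongr
  calc t ^ i ≤ (1 + t) ^ i := by gcongr; linarith
    _ ≤ (1 + t) ^ d := pow_le_pow_right₀ (by linarith)
        ((Finset.mem_range_succ_iff.mp hi).trans hrd)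

/-- A function which is `o((t - x)^r)` at `x` and of polynomial growth is bounded by a small
multiple of `|t - x|^r` plus a multiple of a high even power of `t - x`. -/
lemma exists_abs_le_add_pow {h : ℝ → ℝ} {x A : ℝ} (hx : 0 < x) (hA0 : 0 ≤ A) {r m : ℕ}
    (hA : ∀ t, 0 ≤ t → |h t| ≤ A * (1 + t) ^ (2 * m))
    (ho : h =o[𝓝 x] fun t => (t - x) ^ r) {ε : ℝ} (hε : 0 < ε) :
    ∃ C : ℝ, 0 ≤ C ∧ ∀ t, 0 ≤ t → |h t| ≤ ε * |t - x| ^ r + C * (t - x) ^ (2 * m) := by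
  obtain ⟨δ, hδ, hball⟩ := Metric.eventually_nhds_iff.mp (ho.def hε)
  refine ⟨A * ((1 + x) / δ + 1) ^ (2 * m), by positivity, fun t ht => ?_⟩
  have heven : Even (2 * m) := even_two_mul m
  rcases lt_or_ge |t - x| δ with hlt | hge
  · have h1 := hball (y := t) (by rwa [Real.dist_eq])
    rw [Real.norm_eq_abs, norm_pow, Real.norm_eq_abs] at h1
    have h2 : 0 ≤ A * ((1 + x) / δ + 1) ^ (2 * m) * (t - x) ^ (2 * m) :=
      mul_nonneg (by positivity) (heven.pow_nonneg _)
    linarith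
  · have h1 : 1 + t ≤ ((1 + x) / δ + 1) * |t - x| := by
      have h2 : 1 + x ≤ (1 + x) / δ * |t - x| := by
        rw [div_mul_eq_mul_div, le_div_iff₀ hδ]
        gcongr
      have h3 := le_abs_self (t - x)
      linarith
    calc |h t| ≤ A * (1 + t) ^ (2 * m) := hA t ht
      _ ≤ A * (((1 + x) / δ + 1) * |t - x|) ^ (2 * m) := by gcongr
      _ = A * ((1 + x) / δ + 1) ^ (2 * m) * (t - x) ^ (2 * m) := by
          rw [mul_pow, heven.pow_abs, mul_assoc]
      _ ≤ _ := by
          have : 0 ≤ ε * |t - x| ^ r := by positivity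
          linarith

/-! ### The Stancu shift -/

/-- The argument `(n t + α) / (n + β)` of the operator after the substitution `s = γ t`. -/
noncomputable def stancu (γ α β n s : ℝ) : ℝ := (n * (s / γ) + α) / (n + β)

lemma stancu_nonneg {γ α β n s : ℝ} (hγ : 0 < γ) (hα : 0 ≤ α) (hβ : 0 ≤ β) (hn : 0 < n)
    (hs : 0 ≤ s) : 0 ≤ stancu γ α β n s := by
  unfold stancu; positivity

lemma continuous_stancu (γ α β n : ℝ) : Continuous (stancu γ α β n) := by
  unfold stancu; fun_prop

lemma one_add_stancu_le {γ α β n s : ℝ} (hγ : 0 < γ) (hα : 0 ≤ α) (hβ : 0 ≤ β) (hn : 1 ≤ n)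
    (hs : 0 ≤ s) : 1 + stancu γ α β n s ≤ (1 + α + γ⁻¹) * (1 + s) := by
  have h1 : stancu γ α β n s ≤ s / γ + α := by
    rw [stancu, div_le_iff₀ (by linarith)]
    have : 0 ≤ s / γ := by positivity
    nlinarith [mul_nonneg hα hβ, mul_nonneg this hβ]
  have h2 : 0 < γ⁻¹ := by positivity
  rw [div_eq_mul_inv] at h1
  nlinarith [mul_nonneg hα hs]

lemma abs_comp_stancu_le {γ α β n : ℝ} (hγ : 0 < γ) (hα : 0 ≤ α) (hβ : 0 ≤ β) (hn : 1 ≤ n)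
    {φ : ℝ → ℝ} {A : ℝ} (hA0 : 0 ≤ A) {d : ℕ} (hA : ∀ t, 0 ≤ t → |φ t| ≤ A * (1 + t) ^ d) (s : ℝ)
    (hs : 0 ≤ s) : |φ (stancu γ α β n s)| ≤ A * (1 + α + γ⁻¹) ^ d * (1 + s) ^ d := by
  have h0 := stancu_nonneg hγ hα hβ (by linarith : 0 < n) hs
  refine (hA _ h0).trans ?_
  rw [mul_assoc, ← mul_pow]
  gcongr
  exact one_add_stancu_le hγ hα hβ hn hs

/-- The shift moves even powers of the deviation by at most `O(n ^ (-1))` before raising to the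
power. -/
lemma stancu_sub_pow_le {γ α β n x ρ : ℝ} (hγ : 0 < γ) (hβ : 0 ≤ β) (hn : 1 ≤ n)
    (hρ0 : 0 < ρ) (hρ1 : ρ ≤ 1) (hρ : n / γ * ρ ^ 2 = 1) (j : ℕ) (s : ℝ) :
    (stancu γ α β n s - x) ^ (2 * j) ≤ 2 ^ (2 * j - 1) *
      (γ⁻¹ ^ (2 * j) * (s - γ * x) ^ (2 * j) + (|α - β * x| / γ) ^ (2 * j) * ρ ^ (2 * j)) := by
  have heven : Even (2 * j) := even_two_mul j
  have hnβ : 0 < n + β := by linarith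
  have e : stancu γ α β n s - x = n / (n + β) * (γ⁻¹ * (s - γ * x)) + (α - β * x) / (n + β) := by
    rw [stancu]; field_simp; ring
  rw [e]
  refine (heven.add_pow_le).trans ?_
  gcongr ?_ * (?_ + ?_)
  · rw [← mul_pow, ← heven.pow_abs, ← heven.pow_abs (γ⁻¹ * (s - γ * x)), abs_mul]
    refine pow_le_pow_left₀ (by positivity) (mul_le_of_le_one_left (abs_nonneg _) ?_) _
    rw [abs_of_nonneg (by positivity), div_le_one hnβ]
    linarith
  · rw [← mul_pow, ← heven.pow_abs]
    refine pow_le_pow_left₀ (by positivity) ?_ _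
    have hn' : n * ρ ^ 2 = γ := by field_simp at hρ; linarith
    rw [abs_div, abs_of_pos hnβ, div_le_iff₀ hnβ]
    have h1 : 1 ≤ ρ * (n + β) / γ := by
      rw [le_div_iff₀ hγ, one_mul]
      nlinarith [mul_nonneg hρ0.le hβ, mul_nonneg (sub_nonneg.mpr hρ1) hρ0.le]
    calc |α - β * x| ≤ |α - β * x| * (ρ * (n + β) / γ) := le_mul_of_one_le_right (abs_nonneg _) h1
      _ = _ := by ring

lemma natDegree_comp_linear_le (T : ℝ[X]) {r : ℕ} (hT : T.natDegree ≤ r) (a b : ℝ) :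
    (T.comp (C a * X + C b)).natDegree ≤ r := by
  refine natDegree_comp_le.trans ?_
  calc T.natDegree * (C a * X + C b).natDegree ≤ r * 1 :=
        Nat.mul_le_mul hT (by compute_degree)
    _ = r := mul_one r

lemma coeff_comp_linear (T : ℝ[X]) {r : ℕ} (hT : T.natDegree ≤ r) (a b : ℝ) :
    (T.comp (C a * X + C b)).coeff r = T.coeff r * a ^ r := by
  have e : T.comp (C a * X + C b) = (T.comp (X + C b)).comp (C a * X) := by
    rw [comp_assoc]; simp
  rw [e, comp_C_mul_X_coeff]
  congr 1
  have e2 : T.comp (X + C b) = taylor b T := rfl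
  rw [e2]
  rcases hT.eq_or_lt with h | h
  · rw [← h, coeff_taylor_natDegree]; rfl
  · rw [coeff_eq_zero_of_natDegree_lt h,
      coeff_eq_zero_of_natDegree_lt (by rwa [natDegree_taylor])]

lemma iteratedDeriv_eval (Q : ℝ[X]) (r : ℕ) :
    iteratedDeriv r (fun w => Q.eval w) = fun w => (derivative^[r] Q).eval w := by
  induction r with
  | zero => simp
  | succ r ih =>
    rw [iteratedDeriv_succ, ih, Function.iterate_succ_apply']
    funext w
    exact Polynomial.deriv _

lemma iteratedDeriv_eval_of_natDegree_le (Q : ℝ[X]) {r : ℕ} (hQ : Q.natDegree ≤ r) (w : ℝ) :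
    iteratedDeriv r (fun w => Q.eval w) w = r.factorial * Q.coeff r := by
  have h0 : (derivative^[r] Q).natDegree ≤ 0 := (natDegree_iterate_derivative Q r).trans (by omega)
  rw [iteratedDeriv_eval, eq_C_of_natDegree_le_zero h0, coeff_iterate_derivative]
  simp [Nat.descFactorial_self]

lemma iteratedDeriv_comp_mul_left' (G : ℝ → ℝ) (c : ℝ) (r : ℕ) :
    iteratedDeriv r (fun y => G (c * y)) = fun y => c ^ r * iteratedDeriv r G (c * y) := by
  induction r with
  | zero => simp
  | succ r ih =>
    rw [iteratedDeriv_succ, ih]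
    funext y
    rw [deriv_const_mul_field, deriv_comp_mul_left, iteratedDeriv_succ, smul_eq_mul, pow_succ]
    ring

/-! ### Reduction to the normalized operator -/

lemma integrand_eq_comp_mul {γ α β n : ℝ} (hγ : 0 < γ) (hα : 0 ≤ α) (hβ : 0 ≤ β) (hn : 0 < n)
    {f φ : ℝ → ℝ} (hφ : ∀ t, 0 ≤ t → φ t = f t) (k : ℕ) {t : ℝ} (ht : 0 < t) :
    integrand γ α β n f k t =
      γ * (fun s => bp (n / γ) k s * φ (stancu γ α β n s)) (γ * t) := by
  have h0 : 0 ≤ γ * t := by positivity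
  have e : stancu γ α β n (γ * t) = (n * t + α) / (n + β) := by
    rw [stancu]; field_simp
  simp only
  rw [hφ _ (stancu_nonneg hγ hα hβ hn h0), e, integrand, b, bp]
  ring

lemma integrableOn_integrand {γ α β n : ℝ} (hγ : 0 < γ) (hα : 0 ≤ α) (hβ : 0 ≤ β) (hn : 0 < n)
    {f φ : ℝ → ℝ} (hφ : ∀ t, 0 ≤ t → φ t = f t) {k : ℕ} (hk : k ≠ 0)
    (hi : Integrable (fun s => φ (stancu γ α β n s)) (betaPrime (n / γ) k)) :
    IntegrableOn (integrand γ α β n f k) (Ioi 0) := by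
  rw [integrable_betaPrime_iff (by positivity) hk] at hi
  have h1 : IntegrableOn (fun t => γ *
      (fun s => bp (n / γ) k s * φ (stancu γ α β n s)) (γ * t)) (Ioi 0) := by
    refine Integrable.const_mul ?_ γ
    have := (integrableOn_Ioi_comp_mul_left_iff
      (fun s => bp (n / γ) k s * φ (stancu γ α β n s)) 0 hγ).mpr (by rwa [mul_zero])
    exact this
  exact h1.congr_fun (fun t ht => (integrand_eq_comp_mul hγ hα hβ hn hφ k ht).symm)
    measurableSet_Ioi

lemma term_eq {γ α β n : ℝ} (hγ : 0 < γ) (hα : 0 ≤ α) (hβ : 0 ≤ β) (hn : 0 < n)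
    {f φ : ℝ → ℝ} (hφ : ∀ t, 0 ≤ t → φ t = f t) {k : ℕ} (hk : k ≠ 0) (y : ℝ) :
    term γ α β n f y k =
      nb (n / γ) k (γ * y) * ∫ s, φ (stancu γ α β n s) ∂betaPrime (n / γ) k := by
  rw [term, setIntegral_congr_fun measurableSet_Ioi
    (fun t ht => integrand_eq_comp_mul hγ hα hβ hn hφ k ht), integral_const_mul,
    integral_comp_mul_left_Ioi (fun s => bp (n / γ) k s * φ (stancu γ α β n s)) 0 hγ, mul_zero,
    integral_betaPrime (by positivity) hk, smul_eq_mul, mul_inv_cancel_left₀ hγ.ne']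
  rfl

lemma B_eq_opL {γ α β n : ℝ} (hγ : 0 < γ) (hα : 0 ≤ α) (hβ : 0 ≤ β) (hn : 0 < n)
    {f φ : ℝ → ℝ} (hφ : ∀ t, 0 ≤ t → φ t = f t) {y : ℝ}
    (hs : Summable fun k : ℕ =>
      nb (n / γ) k (γ * y) * ∫ s, φ (stancu γ α β n s) ∂betaPrime (n / γ) k) :
    B γ α β n f y = opL (n / γ) (fun s => φ (stancu γ α β n s)) (γ * y) := by
  rw [opL, hs.tsum_eq_zero_add, B, add_comm]
  congr 1
  · rw [integral_betaPrime_zero, hφ _ (stancu_nonneg hγ hα hβ hn le_rfl)]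
    have e : stancu γ α β n 0 = α / (n + β) := by rw [stancu]; simp
    rw [e]
    rfl
  · congr 1
    funext k
    exact term_eq hγ hα hβ hn hφ k.succ_ne_zero y

lemma differentiableAt_iteratedDeriv_opL {N : ℝ} {d : ℕ} {g : ℝ → ℝ} {A : ℝ} (hN : 0 < N)
    (hd : (d : ℝ) ≤ N) (hg : Continuous g) (hA : ∀ s, 0 ≤ s → |g s| ≤ A * (1 + s) ^ d) {u : ℝ}
    (hu : 0 < u) (i : ℕ) : DifferentiableAt ℝ (iteratedDeriv i (opL N g)) u := by
  have h := iteratedDeriv_re_comp_ofReal (isOpen_halfDisc (u + 1))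
    (differentiableOn_copL hN hd hg hA (u + 1))
    (fun y hy => (copL_ofReal_re (by have : 0 < y := by simpa using hy.1
                                     exact this.le)).symm) i
  have hmem := ofReal_mem_halfDisc hu (by linarith : u < u + 1)
  have h1 := ((h.1.differentiableAt
    ((isOpen_halfDisc (u + 1)).mem_nhds hmem)).hasDerivAt.real_of_complex).differentiableAt
  refine h1.congr_of_eventuallyEq ?_
  filter_upwards [Complex.continuous_ofReal.continuousAt.preimage_mem_nhds
    ((isOpen_halfDisc (u + 1)).mem_nhds hmem)] with y hy using h.2 y hy

/-! ### Convergence of the derivatives -/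

/-- Domination of the operator by even moments about a point. -/
lemma opL_abs_le_of_le {N : ℝ} (hN : 0 < N) {r m : ℕ} (hm : ((2 * m : ℕ) : ℝ) ≤ N) (hrm : r ≤ m)
    {g : ℝ → ℝ} (hg : Continuous g) {A : ℝ} (hA : ∀ s, 0 ≤ s → |g s| ≤ A * (1 + s) ^ (2 * m))
    {u e0 e1 e2 : ℝ}
    (hdom : ∀ s, 0 ≤ s → |g s| ≤ e0 + e1 * (s - u) ^ (2 * r) + e2 * (s - u) ^ (2 * m)) {w : ℝ}
    (hw : 0 ≤ w) : opL N (fun s => |g s|) w ≤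
      e0 + e1 * opL N (fun s => (s - u) ^ (2 * r)) w +
        e2 * opL N (fun s => (s - u) ^ (2 * m)) w := by
  have hr : ((2 * r : ℕ) : ℝ) ≤ N := le_trans (by exact_mod_cast (by omega : 2 * r ≤ 2 * m)) hm
  have hs : ∀ j : ℕ, ((2 * j : ℕ) : ℝ) ≤ N → HasSum
      (fun k : ℕ => nb N k w * ∫ s, (s - u) ^ (2 * j) ∂betaPrime N k)
      (opL N (fun s => (s - u) ^ (2 * j)) w) := by
    intro j hj
    obtain ⟨Q, -, -, hQ⟩ := exists_hasSum_opL_eval hN hj ((X - C u) ^ (2 * j))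
      (by rw [natDegree_pow, natDegree_X_sub_C, mul_one])
    have := (hQ w hw).summable.hasSum
    simp only [eval_pow, eval_sub, eval_X, eval_C] at this
    exact this
  have hsum := (((hasSum_nb hN hw).mul_left e0).add ((hs r hr).mul_left e1)).add
    ((hs m hm).mul_left e2)
  rw [mul_one] at hsum
  rw [← hsum.tsum_eq]
  refine (summable_opL_abs hN hm hg hA hw).tsum_le_tsum (fun k => ?_) hsum.summable
  have i0 : Integrable (fun _ : ℝ => e0) (betaPrime N k) := by
    have := (integrable_pow_betaPrime hN k (j := 0) (by push_cast; linarith)).const_mul e0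
    simpa using this
  have i1 := (integrable_central_betaPrime hN k u (j := 2 * r) (by linarith)).const_mul e1
  have i2 := (integrable_central_betaPrime hN k u (j := 2 * m) (by linarith)).const_mul e2
  have i01 : Integrable (fun s => e0 + e1 * (s - u) ^ (2 * r)) (betaPrime N k) := i0.add i1
  have h1 : ∫ _s, e0 ∂betaPrime N k = e0 := by
    have h2 := bpMoment_zero hN k
    simp only [bpMoment, pow_zero] at h2
    have := integral_const_mul (μ := betaPrime N k) e0 (fun _ => (1 : ℝ))
    simpa only [mul_one, h2] using this
  calc nb N k w * ∫ s, |g s| ∂betaPrime N k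
      ≤ nb N k w * ∫ s, (e0 + e1 * (s - u) ^ (2 * r) + e2 * (s - u) ^ (2 * m))
          ∂betaPrime N k := by
        refine mul_le_mul_of_nonneg_left ?_ (nb_nonneg hN hw k)
        refine integral_mono_ae (integrable_betaPrime_of_le hN hm hg hA k).abs (i01.add i2) ?_
        filter_upwards [ae_nonneg_betaPrime N k] with s hs using hdom s hs
    _ = _ := by
        rw [integral_add i01 i2, integral_add i0 i1, integral_const_mul, integral_const_mul, h1]
        ring

/-- The estimate for the Taylor remainder: a function bounded by
`ε |t - x|^r + C (t - x)^(2m)`, with `r < 2m`, contributes `O(ε) + O(C n ^ (-1 / 2))` to the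
derivative of order `r`. -/
lemma exists_abs_iteratedDeriv_remainder_le {γ α β x : ℝ} (hγ : 0 < γ) (hα : 0 ≤ α) (hβ : 0 ≤ β)
    (hx : 0 < x) {r m : ℕ} (hrm : r < m) :
    ∃ κ₁ κ₂ : ℝ, 0 ≤ κ₁ ∧ 0 ≤ κ₂ ∧ ∀ᶠ n : ℕ in atTop, ∀ (h : ℝ → ℝ) (A ε C : ℝ), Continuous h →
      0 ≤ A → (∀ t, 0 ≤ t → |h t| ≤ A * (1 + t) ^ (2 * m)) → 0 ≤ ε → 0 ≤ C →
      (∀ t, 0 ≤ t → |h t| ≤ ε * |t - x| ^ r + C * (t - x) ^ (2 * m)) →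
      |iteratedDeriv r (opL (n / γ) (fun s => h (stancu γ α β n s))) (γ * x)| ≤
        κ₁ * ε + κ₂ * C * √(γ / n) := by
  set u := γ * x with hu
  have hu0 : 0 < u := by positivity
  obtain ⟨Kr, hKr0, hKr⟩ := exists_opL_sub_pow_le (u + 5) 5 r
  obtain ⟨Km, hKm0, hKm⟩ := exists_opL_sub_pow_le (u + 5) 5 m
  set L : ℝ := |α - β * x| / γ with hL
  have hL0 : 0 ≤ L := by positivity
  set cr : ℝ := 2 ^ (2 * r - 1) with hcr
  set cm : ℝ := 2 ^ (2 * m - 1) with hcm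
  set E : ℝ := r.factorial * Real.exp (2 / u) with hE
  have hE0 : 0 ≤ E := by positivity
  refine ⟨E * (1 + cr * (γ⁻¹ ^ (2 * r) * Kr + L ^ (2 * r))),
    E * (cm * (γ⁻¹ ^ (2 * m) * Km + L ^ (2 * m))), by positivity, by positivity, ?_⟩
  have hρlim : Tendsto (fun n : ℕ => √(γ / n)) atTop (𝓝 0) := by
    have := (tendsto_const_div_atTop_nhds_zero_nat γ).sqrt
    rwa [Real.sqrt_zero] at this
  have hNlim : Tendsto (fun n : ℕ => (n : ℝ) / γ) atTop atTop :=
    tendsto_natCast_atTop_atTop.atTop_div_const hγ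
  have hρ2lim : Tendsto (fun n : ℕ => √(γ / n) ^ 2 / u) atTop (𝓝 0) := by
    have := (hρlim.pow 2).div_const u
    simpa using this
  filter_upwards [hρlim.eventually_le_const one_pos, hρlim.eventually_le_const (half_pos hu0),
    hρ2lim.eventually_le_const one_half_pos, hNlim.eventually_ge_atTop (4 * (m : ℝ)),
    eventually_ge_atTop 1] with n hρ1 hρu hρ2 hNm hn1 h A ε C hc hA0 hA hε hC hh
  have hn1' : (1 : ℝ) ≤ n := by exact_mod_cast hn1
  have hn0 : (0 : ℝ) < n := by linarith
  set ρ := √(γ / n) with hρdef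
  have hρ0 : 0 < ρ := Real.sqrt_pos.mpr (by positivity)
  have hNρ : n / γ * ρ ^ 2 = 1 := by
    rw [hρdef, Real.sq_sqrt (by positivity)]; field_simp
  have hN0 : 0 < n / γ := by positivity
  have hm0 : (0 : ℝ) ≤ m := by positivity
  have hrm' : (r : ℝ) ≤ m := by exact_mod_cast hrm.le
  have hd : ((2 * m : ℕ) : ℝ) ≤ n / γ := by push_cast; linarith
  have hgc : Continuous fun s => h (stancu γ α β n s) := hc.comp (continuous_stancu _ _ _ _)
  have hgA := abs_comp_stancu_le hγ hα hβ hn1' hA0 hA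
  set e0 : ℝ := ε * (1 + cr * L ^ (2 * r)) * ρ ^ r + C * cm * L ^ (2 * m) * ρ ^ (2 * m) with he0
  set e1 : ℝ := ε * cr * γ⁻¹ ^ (2 * r) / ρ ^ r with he1
  set e2 : ℝ := C * cm * γ⁻¹ ^ (2 * m) with he2
  have hdom : ∀ s, 0 ≤ s → |h (stancu γ α β n s)| ≤
      e0 + e1 * (s - u) ^ (2 * r) + e2 * (s - u) ^ (2 * m) := by
    intro s hs
    have h1 := hh _ (stancu_nonneg hγ hα hβ hn0 hs)
    have hvr := stancu_sub_pow_le (x := x) (α := α) hγ hβ hn1' hρ0 hρ1 hNρ r s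
    have hvm := stancu_sub_pow_le (x := x) (α := α) hγ hβ hn1' hρ0 hρ1 hNρ m s
    rw [← hcr, ← hL, ← hu] at hvr
    rw [← hcm, ← hL, ← hu] at hvm
    set v := stancu γ α β n s - x with hv
    have hρr : 0 < ρ ^ r := by positivity
    -- The odd powers of `|v|` are removed by `q ≤ ρ^r + q² / ρ^r`, sharp on the scale `|v| ≈ ρ`.
    have hvabs : |v| ^ r ≤ ρ ^ r + v ^ (2 * r) / ρ ^ r := by
      rw [← (even_two_mul r).pow_abs, mul_comm 2 r, pow_mul]
      set q := |v| ^ r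
      have e : ρ ^ r + q ^ 2 / ρ ^ r - q = ((ρ ^ r - q / 2) ^ 2 + 3 / 4 * q ^ 2) / ρ ^ r := by
        field_simp; ring
      have : 0 ≤ ((ρ ^ r - q / 2) ^ 2 + 3 / 4 * q ^ 2) / ρ ^ r := by positivity
      linarith
    calc |h (stancu γ α β n s)| ≤ ε * |v| ^ r + C * v ^ (2 * m) := h1
      _ ≤ ε * (ρ ^ r + cr * (γ⁻¹ ^ (2 * r) * (s - u) ^ (2 * r) + L ^ (2 * r) * ρ ^ (2 * r)) /
            ρ ^ r) + C * (cm * (γ⁻¹ ^ (2 * m) * (s - u) ^ (2 * m) +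
              L ^ (2 * m) * ρ ^ (2 * m))) := by
          gcongr
          refine hvabs.trans ?_
          gcongr
      _ = e0 + e1 * (s - u) ^ (2 * r) + e2 * (s - u) ^ (2 * m) := by
          have e : ρ ^ (2 * r) = ρ ^ r * ρ ^ r := by rw [two_mul, pow_add]
          rw [he0, he1, he2, e]
          field_simp
          ring
  have hS : ∀ w, 0 ≤ w → |w - u| ≤ 5 * ρ → opL (n / γ) (fun s => |h (stancu γ α β n s)|) w ≤
      e0 + e1 * (Kr * ρ ^ (2 * r)) + e2 * (Km * ρ ^ (2 * m)) := by
    intro w hw hwu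
    have hwW : w ≤ u + 5 := by
      have := (le_abs_self _).trans hwu
      linarith
    refine (opL_abs_le_of_le hN0 hd hrm.le hgc hgA hdom hw).trans ?_
    gcongr
    · exact hKr _ ρ w u hρ0 hρ1 hNρ (by linarith) hw hwW hwu
    · exact hKm _ ρ w u hρ0 hρ1 hNρ hNm hw hwW hwu
  refine (abs_iteratedDeriv_opL_le hd hgc hgA hu0 hρ0 hρ1 hNρ hρu hρ2 hS r).trans ?_
  have hpow : ρ ^ (2 * m) ≤ ρ * ρ ^ r := by
    rw [← pow_succ']
    exact pow_le_pow_of_le_one hρ0.le hρ1 (by omega)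
  have hρr : 0 < ρ ^ r := by positivity
  rw [div_le_iff₀ hρr, ← mul_assoc, ← hE]
  calc E * (e0 + e1 * (Kr * ρ ^ (2 * r)) + e2 * (Km * ρ ^ (2 * m)))
      = E * (1 + cr * (γ⁻¹ ^ (2 * r) * Kr + L ^ (2 * r))) * ε * ρ ^ r +
        E * (cm * (γ⁻¹ ^ (2 * m) * Km + L ^ (2 * m))) * C * ρ ^ (2 * m) := by
        have e : ρ ^ (2 * r) = ρ ^ r * ρ ^ r := by rw [two_mul, pow_add]
        rw [he0, he1, he2, e]
        field_simp
        ring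
    _ ≤ E * (1 + cr * (γ⁻¹ ^ (2 * r) * Kr + L ^ (2 * r))) * ε * ρ ^ r +
        E * (cm * (γ⁻¹ ^ (2 * m) * Km + L ^ (2 * m))) * C * (ρ * ρ ^ r) := by gcongr
    _ = _ := by ring

/-- On the Taylor polynomial, only its leading coefficient contributes to the derivative of
order `r`, because the operator does not raise degrees. -/
lemma iteratedDeriv_opL_eval_stancu {γ α β n : ℝ} (hγ : 0 < γ) (hn : 0 < n) {r : ℕ}
    (hr : (r : ℝ) ≤ n / γ) (T : ℝ[X]) (hT : T.natDegree ≤ r) {u : ℝ} (hu : 0 < u) :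
    iteratedDeriv r (opL (n / γ) (fun s => T.eval (stancu γ α β n s))) u =
      r.factorial * (T.coeff r * (n / γ / (n + β)) ^ r * leadFactor (n / γ) r) := by
  have he : ∀ s, T.eval (stancu γ α β n s) =
      (T.comp (C (n / γ / (n + β)) * X + C (α / (n + β)))).eval s := by
    intro s
    simp only [eval_comp, eval_add, eval_mul, eval_C, eval_X]
    rw [stancu]
    congr 1
    ring
  simp_rw [he]
  obtain ⟨Q, hQ1, hQ2, hQ3⟩ := exists_hasSum_opL_eval (by positivity) hr
    (T.comp (C (n / γ / (n + β)) * X + C (α / (n + β)))) (natDegree_comp_linear_le T hT _ _)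
  have hev : opL (n / γ) (fun s =>
      (T.comp (C (n / γ / (n + β)) * X + C (α / (n + β)))).eval s) =ᶠ[𝓝 u] fun w => Q.eval w := by
    filter_upwards [lt_mem_nhds hu] with w hw using (hQ3 w hw.le).tsum_eq
  rw [hev.iteratedDeriv_eq, iteratedDeriv_eval_of_natDegree_le Q hQ1, hQ2,
    coeff_comp_linear T hT]

end BDS

theorem theorem5 (γ α β μ : ℝ) (hγ : 0 < γ) (hα : 0 ≤ α) (hαβ : α ≤ β) (hμ : 0 < μ)
    (f : ℝ → ℝ) (hf : f ∈ BDS.CMu μ) (r : ℕ) (x : ℝ) (hx : 0 < x)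
    (hfx : BDS.DerivExistsAt r f x) :
    (∀ᶠ n : ℕ in atTop, BDS.WellDefined γ α β n f ∧
      BDS.DerivExistsAt r (fun y => BDS.B γ α β n f y) x) ∧
    Tendsto (fun n : ℕ => iteratedDeriv r (fun y => BDS.B γ α β n f y) x) atTop
      (𝓝 (iteratedDeriv r f x)) := by
  have hβ : 0 ≤ β := hα.trans hαβ
  obtain ⟨hfc, M, hM0, hM⟩ := hf
  -- The values at negative arguments are irrelevant: `f` is replaced by a globally continuous `φ`.
  set φ : ℝ → ℝ := fun t => f (max t 0) with hφdef
  have hφ : ∀ t, 0 ≤ t → φ t = f t := fun t ht => by rw [hφdef]; simp only [max_eq_left ht]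
  have hφc : Continuous φ := hfc.comp_continuous (by fun_prop) fun t => le_max_right t 0
  -- The power `2m` dominates the growth of `f` and exceeds the degree of its Taylor polynomial.
  set m : ℕ := ⌈μ⌉₊ + r + 1 with hm
  have hrm : r < m := by omega
  have hφA : ∀ t, 0 ≤ t → |φ t| ≤ M * (1 + t) ^ (2 * m) := by
    intro t ht
    rw [hφ t ht]
    refine (hM t ht).trans ?_
    gcongr
    calc t ^ μ ≤ (1 + t) ^ μ := by gcongr; linarith
      _ ≤ (1 + t) ^ ((2 * m : ℕ) : ℝ) := by
          refine Real.rpow_le_rpow_of_exponent_le (by linarith) ((Nat.le_ceil μ).trans ?_)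
          exact_mod_cast (by omega : ⌈μ⌉₊ ≤ 2 * m)
      _ = _ := Real.rpow_natCast _ _
  set u := γ * x with hu
  have hu0 : 0 < u := by positivity
  have hNlim : Tendsto (fun n : ℕ => (n : ℝ) / γ) atTop atTop :=
    tendsto_natCast_atTop_atTop.atTop_div_const hγ
  have hlarge : ∀ᶠ n : ℕ in atTop, (1 : ℝ) ≤ n ∧ ((2 * m : ℕ) : ℝ) ≤ n / γ := by
    filter_upwards [eventually_ge_atTop 1, hNlim.eventually_ge_atTop ((2 * m : ℕ) : ℝ)]
      with n h1 h2 using ⟨by exact_mod_cast h1, h2⟩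
  have hgc : ∀ n : ℕ, Continuous fun s => φ (BDS.stancu γ α β n s) :=
    fun n => hφc.comp (BDS.continuous_stancu _ _ _ _)
  have hBderiv : ∀ n : ℕ, (1 : ℝ) ≤ n → ((2 * m : ℕ) : ℝ) ≤ n / γ → ∀ i : ℕ, ∀ y : ℝ, 0 < y →
      iteratedDeriv i (fun y => BDS.B γ α β n f y) y =
        γ ^ i * iteratedDeriv i (BDS.opL (n / γ) fun s => φ (BDS.stancu γ α β n s)) (γ * y) := by
    intro n hn1 hnm i y hy
    have hn0 : (0 : ℝ) < n := by linarith
    have hev : (fun y => BDS.B γ α β n f y) =ᶠ[𝓝 y]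
        fun y => BDS.opL (n / γ) (fun s => φ (BDS.stancu γ α β n s)) (γ * y) := by
      filter_upwards [lt_mem_nhds hy] with z hz
      exact BDS.B_eq_opL hγ hα hβ hn0 hφ (BDS.summable_opL (by positivity) hnm (hgc n)
        (BDS.abs_comp_stancu_le hγ hα hβ hn1 hM0.le hφA) (by positivity))
    rw [hev.iteratedDeriv_eq, BDS.iteratedDeriv_comp_mul_left']
  have hBdiff : ∀ n : ℕ, (1 : ℝ) ≤ n → ((2 * m : ℕ) : ℝ) ≤ n / γ → ∀ i : ℕ, ∀ y : ℝ, 0 < y →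
      DifferentiableAt ℝ (iteratedDeriv i fun y => BDS.B γ α β n f y) y := by
    intro n hn1 hnm i y hy
    have hn0 : (0 : ℝ) < n := by linarith
    have hev : iteratedDeriv i (fun y => BDS.B γ α β n f y) =ᶠ[𝓝 y] fun y =>
        γ ^ i * iteratedDeriv i (BDS.opL (n / γ) fun s => φ (BDS.stancu γ α β n s)) (γ * y) := by
      filter_upwards [lt_mem_nhds hy] with z hz using hBderiv n hn1 hnm i z hz
    refine DifferentiableAt.congr_of_eventuallyEq ?_ hev
    have h1 := BDS.differentiableAt_iteratedDeriv_opL (u := γ * y) (by positivity) hnm (hgc n)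
      (BDS.abs_comp_stancu_le hγ hα hβ hn1 hM0.le hφA) (by positivity) i
    exact (h1.comp y (by fun_prop : DifferentiableAt ℝ (fun y => γ * y) y)).const_mul _
  refine ⟨?_, ?_⟩
  · filter_upwards [hlarge] with n hn
    obtain ⟨hn1, hnm⟩ := hn
    have hn0 : (0 : ℝ) < n := by linarith
    have hgA := BDS.abs_comp_stancu_le hγ hα hβ hn1 hM0.le hφA
    refine ⟨⟨fun k hk => ?_, fun y hy => ?_⟩, fun i _ => ?_, fun i _ => ?_⟩
    · exact BDS.integrableOn_integrand hγ hα hβ hn0 hφ (by omega)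
        (BDS.integrable_betaPrime_of_le (by positivity) hnm (hgc n) hgA k)
    · have hs := (summable_nat_add_iff 1).mpr
        (BDS.summable_opL (w := γ * y) (by positivity) hnm (hgc n) hgA (by positivity))
      exact hs.congr fun k => (BDS.term_eq hγ hα hβ hn0 hφ k.succ_ne_zero y).symm
    · filter_upwards [lt_mem_nhds hx] with y hy using hBdiff n hn1 hnm i y hy
    · exact hBdiff n hn1 hnm i x hx
  · obtain ⟨T, hT1, hT2, hT3⟩ := BDS.exists_taylor_peano r
      ((hfc x hx.le).continuousAt (Ici_mem_nhds hx)) hfx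
    obtain ⟨A', hA'0, hA'⟩ := BDS.exists_abs_eval_le T hT1 (by omega : r ≤ 2 * m)
    set h : ℝ → ℝ := fun t => φ t - T.eval t with hh
    have hhc : Continuous h := hφc.sub T.continuous
    have hhA : ∀ t, 0 ≤ t → |h t| ≤ (M + A') * (1 + t) ^ (2 * m) := fun t ht => by
      rw [add_mul]
      exact (abs_sub _ _).trans (add_le_add (hφA t ht) (hA' t ht))
    have hho : h =o[𝓝 x] fun t => (t - x) ^ r := by
      refine hT3.congr' ?_ EventuallyEq.rfl
      filter_upwards [lt_mem_nhds hx] with t ht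
      rw [hh]
      simp only [hφ t ht.le]
    obtain ⟨κ₁, κ₂, hκ₁, hκ₂, hκ⟩ :=
      BDS.exists_abs_iteratedDeriv_remainder_le hγ hα hβ hx hrm
    have hρlim : Tendsto (fun n : ℕ => √(γ / n)) atTop (𝓝 0) := by
      have := (tendsto_const_div_atTop_nhds_zero_nat γ).sqrt
      rwa [Real.sqrt_zero] at this
    have hrem : Tendsto (fun n : ℕ =>
        iteratedDeriv r (BDS.opL (n / γ) (fun s => h (BDS.stancu γ α β n s))) u) atTop (𝓝 0) := by
      rw [Metric.tendsto_nhds]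
      intro δ hδ
      set ε : ℝ := δ / (2 * (κ₁ + 1)) with hε
      have hε0 : 0 < ε := by positivity
      obtain ⟨c, hc0, hc⟩ := BDS.exists_abs_le_add_pow hx (by positivity) hhA hho hε0
      have hlim : Tendsto (fun n : ℕ => κ₂ * c * √(γ / n)) atTop (𝓝 0) := by
        simpa using hρlim.const_mul (κ₂ * c)
      filter_upwards [hκ, hlim.eventually_lt_const (half_pos hδ)] with n h1 h2
      rw [Real.dist_eq, sub_zero]
      refine (h1 h (M + A') ε c hhc (by positivity) hhA hε0.le hc0 hc).trans_lt ?_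
      have h3 : κ₁ * ε ≤ δ / 2 := by
        rw [hε, mul_div_assoc', div_le_div_iff₀ (by positivity) two_pos]
        nlinarith
      linarith
    have hlead : Tendsto (fun n : ℕ => γ ^ r * (r.factorial *
        (T.coeff r * ((n : ℝ) / γ / (n + β)) ^ r * BDS.leadFactor (n / γ) r))) atTop
        (𝓝 (iteratedDeriv r f x)) := by
      have h1 : Tendsto (fun n : ℕ => (n : ℝ) / (n + β)) atTop (𝓝 1) := by
        have h2 : Tendsto (fun n : ℕ => 1 - β / ((n : ℝ) + β)) atTop (𝓝 (1 - 0)) :=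
          tendsto_const_nhds.sub (tendsto_const_nhds.div_atTop
            (tendsto_atTop_add_const_right _ _ tendsto_natCast_atTop_atTop))
        rw [sub_zero] at h2
        refine h2.congr' ?_
        filter_upwards [eventually_ge_atTop 1] with n hn
        have hn0 : (0 : ℝ) < n := by exact_mod_cast hn
        field_simp
        ring
      have h3 := (((h1.pow r).mul ((BDS.tendsto_leadFactor r).comp hNlim)).const_mul
        (r.factorial * T.coeff r))
      have hfac : (r.factorial : ℝ) ≠ 0 := by positivity
      rw [one_pow, mul_one, mul_one, hT2, mul_div_cancel₀ _ hfac] at h3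
      refine h3.congr fun n => ?_
      have e : (n : ℝ) / γ / (n + β) = n / (n + β) * γ⁻¹ := by ring
      rw [e, mul_pow, hT2]
      simp only [Function.comp_apply, inv_pow]
      field_simp
    have hsum := hlead.add (hrem.const_mul (γ ^ r))
    rw [mul_zero, add_zero] at hsum
    refine hsum.congr' ?_
    filter_upwards [hlarge] with n hn
    obtain ⟨hn1, hnm⟩ := hn
    have hn0 : (0 : ℝ) < n := by linarith
    have hN0 : 0 < (n : ℝ) / γ := by positivity
    have hTc : Continuous fun s => T.eval (BDS.stancu γ α β n s) :=
      T.continuous.comp (BDS.continuous_stancu _ _ _ _)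
    have hhc' : Continuous fun s => h (BDS.stancu γ α β n s) :=
      hhc.comp (BDS.continuous_stancu _ _ _ _)
    have hTA := BDS.abs_comp_stancu_le hγ hα hβ hn1 hA'0 hA'
    have hhA' := BDS.abs_comp_stancu_le hγ hα hβ hn1 (by positivity) hhA
    have hrN : (r : ℝ) ≤ n / γ := by
      refine le_trans ?_ hnm
      exact_mod_cast (by omega : r ≤ 2 * m)
    have hsplit : BDS.opL (n / γ) (fun s => φ (BDS.stancu γ α β n s)) =ᶠ[𝓝 u]
        BDS.opL (n / γ) (fun s => T.eval (BDS.stancu γ α β n s)) +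
          BDS.opL (n / γ) (fun s => h (BDS.stancu γ α β n s)) := by
      filter_upwards [lt_mem_nhds hu0] with w hw
      rw [Pi.add_apply, ← BDS.opL_add hN0 hnm hTc hhc' hTA hhA' hw.le]
      congr 1
      funext s
      rw [hh]
      ring
    rw [hBderiv n hn1 hnm r x hx, ← hu, hsplit.iteratedDeriv_eq,
      iteratedDeriv_add (BDS.contDiffAt_opL hN0 hnm hTc hTA hu0 r)
        (BDS.contDiffAt_opL hN0 hnm hhc' hhA' hu0 r),
      BDS.iteratedDeriv_opL_eval_stancu hγ hn0 hrN T hT1 hu0, mul_add]
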